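/- **Setting.** Let $(T,Y,\mathbf X)\in\{0,1\}\times\mathbb R\times\mathbb R^p$ be a random vector with $E|Y|<\infty$, let $(T_i,Y_i,\mathbf X_i)$, $i=1,\dots,n$ $(n\ge 1)$, be i.i.d. copies of it (only $(T_i,T_iY_i,\mathbf X_i)$ is observed), put $\pi(\mathbf X)=P(T=1\mid\mathbf X)$, $m(\mathbf X)=E(Y\mid\mathbf X)$, $\varepsilon=Y-m(\mathbf X)$, and let $\mathbf h:\mathbb R^p\to\mathbb R^d$ be measurable, $d\ge 2$. For a random variable $W$ let $\|W\|_{\psi_2}=\inf\{c>0: E[\exp(W^2/c^2)-1]\le 1\}$ ($\inf\emptyset=\infty$); for a random vector take the maximum over the coordinates; for $\|W\mid\mathbf X=\mathbf x\|_{\psi_2}$ use the conditional law of $W$ given $\mathbf X=\mathbf x$. Assume, for constants $\delta_\pi\in(0,1]$ and $\sigma_\varepsilon,\sigma_{\mathbf h},C\ge 0$: 1. (Ignorability and positivity) $T$ and $Y$ are conditionally independent given $\mathbf X$, and $\pi(\mathbf X)\ge\delta_\pi$ a.s. 2. (Sub-Gaussian tails) $\|\varepsilon\|_{\psi_2}\le\sigma_\varepsilon$,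 $\|\mathbf h(\mathbf X)\|_{\psi_2}\le\sigma_{\mathbf h}$, and for some measurable function $\sigma_\varepsilon(\cdot)$ with $0\le\sigma_\varepsilon(\cdot)\le\sigma_\varepsilon$, $\|\varepsilon\mid\mathbf X=\mathbf x\|_{\psi_2}\le\sigma_\varepsilon(\mathbf x)$ for almost every $\mathbf x$. 3. (Tail bounds for $\widehat\pi$) $\widehat\pi(\cdot)$ is computed from $(T_i,\mathbf X_i)_{i=1}^n$ only, and for some $v_{n,\pi}\ge 0$, $q_{n,\pi}\in[0,1]$, $$P\{|\widehat\pi(\mathbf X_i)-\pi(\mathbf X_i)|>t\,v_{n,\pi}\}\le C e^{-t^2}+q_{n,\pi}\qquad\text{for all }t\ge 0,\ 1\le i\le n .$$ Define $$\mathbf T_{\pi,n}=\frac1n\sum_{i=1}^n\Big\{\frac{T_i}{\widehat\pi(\mathbf X_i)}-\frac{T_i}{\pi(\mathbf X_i)}\Big\}\{Y_i-m(\mathbf X_i)\}\,\mathbf h(\mathbf X_i)\in\mathbb R^d,\qquad \|\boldsymbol\mu^{(2)}_{\mathbf h}\|_\infty=\max_{1\le j\le d}E\{\mathbf h_{[j]}^2(\mathbf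 X)\}.$$ **Theorem (Control of $\|\mathbf T_{\pi,n}\|_\infty$).** (i) For all constants $c,c_1,c_2,c_3>1$ with $c_2v_{n,\pi}\sqrt{\log(nd)}\le\delta_\pi/2$ and $c_3\sqrt{(\log d)/n}<1$, with probability at least $$1-2d^{-(c^2-1)}-4d^{-(c_3^2-1)}-2C(nd)^{-(c_1^2-1)}-2C(nd)^{-(c_2^2-1)}-4q_{n,\pi}(nd)$$ we have $$\|\mathbf T_{\pi,n}\|_\infty\le c\sqrt{\frac{\log d}{n}}\,\{v_{n,\pi}\sqrt{\log(nd)}\}\,C_1\left(\frac{\|\boldsymbol\mu^{(2)}_{\mathbf h}\|_\infty}{\delta_\pi}+C_2\sqrt{\frac{\log d}{n}}\right)^{1/2},$$ where $C_1=c_1(4\sqrt2\,\sigma_\varepsilon/\delta_\pi)$ and $C_2=c_3(\sqrt2\,\sigma_\pi+K_\pi)$ with $\sigma_\pi=2\sqrt2\,\sigma_{\mathbf h}^2\delta_\pi^{-2}$ and $K_\pi=2\sigma_{\mathbf h}^2\delta_\pi^{-2}$. (ii) Consider a sequence of such models, one for each $n\ge 1$, in which $p$, $d\ge 2$, $\mathbf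 h$, $\widehat\pi$ and the distribution of the data may all depend on $n$, while $\delta_\pi,\sigma_\varepsilon,\sigma_{\mathbf h},C$ do not. Assume that $v_{n,\pi}\sqrt{\log(nd)}=o(1)$, that $q_{n,\pi}=o(n^{-1}d^{-1})$, and that for some constant $c_3>1$, $c_3\sqrt{(\log d)/n}<1$ for all large $n$. Then $$\|\mathbf T_{\pi,n}\|_\infty=O_P\Big(\sqrt{\tfrac{\log d}{n}}\,\{v_{n,\pi}\sqrt{\log(nd)}\}\Big)\qquad\text{and}\qquad\|\mathbf T_{\pi,n}\|_\infty=o_P\Big(\sqrt{\tfrac{\log d}{n}}\Big).$$ -/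

import Mathlib

open MeasureTheory ProbabilityTheory Filter Topology
open scoped ENNReal

namespace DDR

noncomputable section

/-! Orlicz norms -/

/-- The `ψ_α`-Orlicz norm `inf {c > 0 : E[exp ((|X| / c) ^ α) - 1] ≤ 1}` of a real random variable,
with value `∞` if no such `c` exists. -/
def orliczNorm {Ω : Type*} [MeasurableSpace Ω] (α : ℝ) (X : Ω → ℝ) (P : Measure Ω) : ℝ≥0∞ :=
  ⨅ (c : ℝ) (_ : 0 < c)
    (_ : ∫⁻ ω, ENNReal.ofReal (Real.exp ((|X ω| / c) ^ α) - 1) ∂P ≤ 1), ENNReal.ofReal c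

/-- The `ψ_α`-Orlicz norm of a random vector: the maximum of the norms of its coordinates. -/
def orliczNormVec {Ω : Type*} [MeasurableSpace Ω] {d : ℕ} (α : ℝ) (X : Ω → Fin d → ℝ)
    (P : Measure Ω) : ℝ≥0∞ :=
  ⨆ j : Fin d, orliczNorm α (fun ω => X ω j) P

/-! The full data vector and its law -/

/-- Values of the full data vector `(T, Y, X)`: `T` is the indicator that the outcome is observed,
`Y` the outcome, `X` the covariate vector in `ℝ^p`. -/
abbrev FullData (p : ℕ) : Type := Bool × ℝ × (Fin p → ℝ)

/-- The indicator `T`, as a Boolean. -/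
def obsT {p : ℕ} (z : FullData p) : Bool := z.1

/-- The indicator `T`, as a real number in `{0, 1}`. -/
def indT {p : ℕ} (z : FullData p) : ℝ := if obsT z then 1 else 0

/-- The outcome `Y`. -/
def outY {p : ℕ} (z : FullData p) : ℝ := z.2.1

/-- The covariate vector `X`. -/
def covX {p : ℕ} (z : FullData p) : Fin p → ℝ := z.2.2

theorem measurable_covX {p : ℕ} : Measurable (covX : FullData p → Fin p → ℝ) :=
  measurable_snd.comp measurable_snd

/-- The σ-algebra generated by `X`. -/
abbrev sigmaX (p : ℕ) : MeasurableSpace (FullData p) :=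
  MeasurableSpace.comap (covX : FullData p → Fin p → ℝ) inferInstance

theorem sigmaX_le (p : ℕ) : sigmaX p ≤ (inferInstance : MeasurableSpace (FullData p)) :=
  measurable_covX.comap_le

section Population

variable {p d : ℕ} (ν : Measure (FullData p)) [IsProbabilityMeasure ν]

/-- `π` is (a version of) the propensity score: `π(X) = P(T = 1 | X)` almost surely. -/
def IsPropensityScore (π : (Fin p → ℝ) → ℝ) : Prop :=
  Measurable π ∧ (fun z => π (covX z)) =ᵐ[ν] ν[indT | sigmaX p]

/-- `m` is (a version of) the outcome regression: `m(X) = E(Y | X)` almost surely. -/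
def IsOutcomeRegression (m : (Fin p → ℝ) → ℝ) : Prop :=
  Integrable outY ν ∧ Measurable m ∧ (fun z => m (covX z)) =ᵐ[ν] ν[outY | sigmaX p]

/-- Ignorability (`T` and `Y` are conditionally independent given `X`) and positivity
(`π(X) ≥ δ > 0` almost surely, with `δ ≤ 1`). -/
structure BasicAssumptions (π : (Fin p → ℝ) → ℝ) (δ : ℝ) : Prop where
  ignorability : CondIndepFun (sigmaX p) (sigmaX_le p) obsT outY ν
  delta_pos : 0 < δ
  delta_le_one : δ ≤ 1
  positivity : ∀ᵐ x ∂(ν.map covX), δ ≤ π x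

/-- The error `ε = Y - m(X)`. -/
def err (m : (Fin p → ℝ) → ℝ) (z : FullData p) : ℝ := outY z - m (covX z)

/-- The Orlicz norm of `ε` given `X = x`, i.e. under the conditional law of `ε` given `X = x`. -/
def condErrOrliczNorm (α : ℝ) (m : (Fin p → ℝ) → ℝ) (x : Fin p → ℝ) : ℝ≥0∞ :=
  orliczNorm α (fun e : ℝ => e) (condDistrib (err m) covX ν x)

/-- `ε` and `h(X)` are sub-Gaussian, and `ε` given `X` is conditionally sub-Gaussian with a norm
`σ_ε(X)` that is bounded by `σ_ε`. -/
structure SubGaussianAssumptions (m : (Fin p → ℝ) → ℝ) (h : (Fin p → ℝ) → Fin d → ℝ)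
    (σε σh : ℝ) : Prop where
  sigma_err_nonneg : 0 ≤ σε
  sigma_h_nonneg : 0 ≤ σh
  err_subGaussian : orliczNorm 2 (err m) ν ≤ ENNReal.ofReal σε
  h_subGaussian : orliczNormVec 2 (fun z => h (covX z)) ν ≤ ENNReal.ofReal σh
  err_cond_subGaussian : ∃ s : (Fin p → ℝ) → ℝ, Measurable s ∧
    ∀ᵐ x ∂(ν.map covX), 0 ≤ s x ∧ s x ≤ σε ∧ condErrOrliczNorm ν 2 m x ≤ ENNReal.ofReal (s x)

/-- The vector `μ_h^{(2)}` of second moments `E{h_j(X)^2}`. Its norm is the maximum norm. -/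
def secondMoment (h : (Fin p → ℝ) → Fin d → ℝ) : Fin d → ℝ :=
  fun j => ∫ z, (h (covX z) j) ^ 2 ∂ν

end Population

section Sample

variable {Ω : Type*} [MeasurableSpace Ω] {n p d : ℕ}

/-- `Z_1, …, Z_n` are independent with common law `ν`. -/
structure IsIIDSample (P : Measure Ω) (Z : Fin n → Ω → FullData p) (ν : Measure (FullData p)) :
    Prop where
  measurable : ∀ i, Measurable (Z i)
  indep : iIndepFun Z P
  law : ∀ i, P.map (Z i) = ν

/-- A procedure that turns the data `(T_i, X_i)`, `i = 1, …, n`, into a function on `ℝ^p`. -/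
abbrev Procedure (n p : ℕ) : Type := (Fin n → Bool × (Fin p → ℝ)) → (Fin p → ℝ) → ℝ

/-- The fitted propensity score `π̂`, computed from the pairs `(T_i, X_i)` only. -/
def piHat (A : Procedure n p) (Z : Fin n → Ω → FullData p) (ω : Ω) : (Fin p → ℝ) → ℝ :=
  A (fun i => (obsT (Z i ω), covX (Z i ω)))

/-- Pointwise tail bounds for `π̂ - π` at the training points, with rate `v`, constant `C` and
additional probability `q`. (Of the procedure it is only asked that its fitted values at the
training points are measurable functions of the data.) -/
structure TailAssumptions (P : Measure Ω) (Z : Fin n → Ω → FullData p) (A : Procedure n p)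
    (π : (Fin p → ℝ) → ℝ) (v q C : ℝ) : Prop where
  measurable_fit : ∀ i, Measurable fun D : Fin n → Bool × (Fin p → ℝ) => A D (D i).2
  v_nonneg : 0 ≤ v
  q_nonneg : 0 ≤ q
  q_le_one : q ≤ 1
  C_nonneg : 0 ≤ C
  tail : ∀ t : ℝ, 0 ≤ t → ∀ i : Fin n,
    P.real {ω | t * v < |piHat A Z ω (covX (Z i ω)) - π (covX (Z i ω))|} ≤
      C * Real.exp (-t ^ 2) + q

/-- `T_π(z) = {T / π̂(X) - T / π(X)} {Y - m(X)} h(X)`. -/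
def tPi (πhat π m : (Fin p → ℝ) → ℝ) (h : (Fin p → ℝ) → Fin d → ℝ) (z : FullData p) :
    Fin d → ℝ :=
  ((indT z / πhat (covX z) - indT z / π (covX z)) * (outY z - m (covX z))) • h (covX z)

/-- `T_{π,n} = n⁻¹ ∑ T_π(Z_i)`. Its norm as an element of `Fin d → ℝ` is the maximum norm. -/
def tPiAvg (A : Procedure n p) (Z : Fin n → Ω → FullData p) (π m : (Fin p → ℝ) → ℝ)
    (h : (Fin p → ℝ) → Fin d → ℝ) (ω : Ω) : Fin d → ℝ :=
  (1 / (n : ℝ)) • ∑ i, tPi (piHat A Z ω) π m h (Z i ω)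

/-- All the standing assumptions for one sample size `n` and one dimension `d ≥ 2`. -/
structure ModelAssumptions (P : Measure Ω) (Z : Fin n → Ω → FullData p)
    (ν : Measure (FullData p)) [IsProbabilityMeasure ν] (A : Procedure n p)
    (π m : (Fin p → ℝ) → ℝ) (h : (Fin p → ℝ) → Fin d → ℝ) (v q C δ σε σh : ℝ) : Prop where
  one_le_n : 1 ≤ n
  two_le_d : 2 ≤ d
  sample : IsIIDSample P Z ν
  propensity : IsPropensityScore ν π
  regression : IsOutcomeRegression ν m
  measurable_h : Measurable h
  basic : BasicAssumptions ν π δ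
  subGaussian : SubGaussianAssumptions ν m h σε σh
  tail : TailAssumptions P Z A π v q C

end Sample

/-- `C_1 = c_1 (4 √2 σ_ε / δ_π)`. -/
def const1 (c₁ σε δ : ℝ) : ℝ := c₁ * (4 * √2 * σε / δ)

/-- `C_2 = c_3 (√2 σ_π + K_π)`, with `σ_π = 2 √2 σ_h² / δ_π²` and `K_π = 2 σ_h² / δ_π²`. -/
def const2 (c₃ σh δ : ℝ) : ℝ :=
  c₃ * (√2 * (2 * √2 * σh ^ 2 / δ ^ 2) + 2 * σh ^ 2 / δ ^ 2)

end

end DDR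

namespace DDR

/-! Exponential inequalities -/

/-! Each coordinate of `tPiAvg` is a weighted sum `∑ b_i ε_i` whose weights depend only on the pairs
`(T_i, X_i)`, because `π̂` does. By ignorability, `ε_i` given the pairs keeps its law given `X_i`,
which is centred with moment generating function at most `exp (2 σ_ε² t²)`. So, given the pairs, the
sum is sub-Gaussian with proxy `σ_ε² ∑ b_i²`, even though `π̂` makes every weight depend on all
pairs (`lintegral_pi_mul_prod_exp_err_le`, `pi_measure_sqrt_lt_abs_sum_err_le`).

It remains to bound `∑ b_i²`. If `|π̂ - π|` is at most `c₁ v √log(nd)` and at most `δ/2` at the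
training points, then `b_i²` is at most `n⁻² (2 c₁ v √log(nd) / δ)²` times `T_i h_j(X_i)² / π(X_i)²`
(`errWeight_sq_le`). The closeness follows from a union bound over the `n` points. The averages of
`T h_j² / π²` obey a Bernstein inequality (`pi_measure_lt_sum_le_exp`): these variables are
sub-exponential since `h_j(X)` is sub-Gaussian, and their mean is at most `‖μ‖/δ` since conditioning
on `X` turns `T` into `π(X)`. A union bound over the `d` coordinates, at level `c √log d`, finishes
the non-asymptotic part.

Along a sequence, `d` may stay bounded, so the exceptional powers have to be made small by large
constants. This is free for `c, c₁, c₂`, as `v √log(nd) → 0`; the constraint on `c₃` calls for a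
split on the size of `d` (`exists_bernstein_threshold`). -/

theorem exp_le_one_add_add_sq_mul_exp_abs (x : ℝ) :
    Real.exp x ≤ 1 + x + x ^ 2 / 2 * Real.exp |x| := by
  rcases le_total 0 x with hx | hx
  · rw [abs_of_nonneg hx]
    -- The claim divided by `exp x`: this function equals `1` at `0` and increases on `[0, ∞)`.
    have hd : ∀ y : ℝ, HasDerivAt (fun y : ℝ => (1 + y) * Real.exp (-y) + y ^ 2 / 2)
        (y * (1 - Real.exp (-y))) y := by
      intro y
      have h1 : HasDerivAt (fun y : ℝ => Real.exp (-y)) (-Real.exp (-y)) y := by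
        simpa using (hasDerivAt_neg y).exp
      have h2 : HasDerivAt (fun y : ℝ => 1 + y) 1 y := (hasDerivAt_id y).const_add 1
      have h3 : HasDerivAt (fun y : ℝ => y ^ 2 / 2) y y := by
        simpa using (hasDerivAt_pow 2 y).div_const 2
      refine ((h2.mul h1).add h3).congr_deriv ?_
      ring
    have hmono : MonotoneOn (fun y : ℝ => (1 + y) * Real.exp (-y) + y ^ 2 / 2) (Set.Ici 0) := by
      refine monotoneOn_of_deriv_nonneg (convex_Ici 0)
        (fun y _ => (hd y).continuousAt.continuousWithinAt)
        (fun y _ => (hd y).differentiableAt.differentiableWithinAt) ?_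
      intro y hy
      rw [interior_Ici] at hy
      rw [(hd y).deriv]
      have hy' : 0 < y := hy
      exact mul_nonneg hy'.le (sub_nonneg.2 (Real.exp_le_one_iff.2 (by linarith)))
    have h := hmono (Set.self_mem_Ici) (Set.mem_Ici.2 hx) hx
    simp only [neg_zero, Real.exp_zero] at h
    have hpos := Real.exp_pos x
    have h' : 1 * Real.exp x ≤ ((1 + x) * Real.exp (-x) + x ^ 2 / 2) * Real.exp x :=
      mul_le_mul_of_nonneg_right (by linarith) hpos.le
    have he : Real.exp (-x) * Real.exp x = 1 := by rw [← Real.exp_add]; simp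
    calc Real.exp x ≤ ((1 + x) * Real.exp (-x) + x ^ 2 / 2) * Real.exp x := by linarith
      _ = (1 + x) * (Real.exp (-x) * Real.exp x) + x ^ 2 / 2 * Real.exp x := by ring
      _ = _ := by rw [he]; ring
  · have h1 : 1 + -x + (-x) ^ 2 / 2 ≤ Real.exp (-x) :=
      Real.quadratic_le_exp_of_nonneg (by linarith)
    have h2 : Real.exp x * Real.exp (-x) = 1 := by rw [← Real.exp_add]; simp
    have h3 : Real.exp x ≤ 1 + x + x ^ 2 / 2 := by
      have hq : 0 < 1 + x + x ^ 2 / 2 := by nlinarith [sq_nonneg (x + 1)]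
      have hp := Real.exp_pos x
      -- `(1 + x + x²/2)(1 - x + x²/2) = 1 + x⁴/4`.
      have hxx : 1 ≤ (1 + x + x ^ 2 / 2) * Real.exp (-x) := by
        calc (1 : ℝ) ≤ (1 + x + x ^ 2 / 2) * (1 + -x + (-x) ^ 2 / 2) := by
              nlinarith [sq_nonneg (x ^ 2)]
          _ ≤ _ := mul_le_mul_of_nonneg_left h1 hq.le
      calc Real.exp x = Real.exp x * 1 := by ring
        _ ≤ Real.exp x * ((1 + x + x ^ 2 / 2) * Real.exp (-x)) :=
            mul_le_mul_of_nonneg_left hxx hp.le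
        _ = (1 + x + x ^ 2 / 2) * (Real.exp x * Real.exp (-x)) := by ring
        _ = _ := by rw [h2]; ring
    have h4 : 1 ≤ Real.exp |x| := Real.one_le_exp (abs_nonneg x)
    nlinarith [sq_nonneg x]

theorem sq_div_two_mul_exp_le_exp_sq (y : ℝ) : y ^ 2 / 2 * Real.exp y ≤ Real.exp (y ^ 2) := by
  have h : y ^ 2 / 2 ≤ Real.exp (y ^ 2 - y) := by
    have := Real.add_one_le_exp (y ^ 2 - y)
    nlinarith [sq_nonneg (y - 1)]
  calc y ^ 2 / 2 * Real.exp y ≤ Real.exp (y ^ 2 - y) * Real.exp y :=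
        mul_le_mul_of_nonneg_right h (Real.exp_pos y).le
    _ = _ := by rw [← Real.exp_add]; congr 1; ring

/-- A second-order expansion whose remainder is absorbed by `exp (y²)`, the quantity that a
`ψ₂`-norm controls. The linear term is kept so that centring can remove it. -/
theorem exp_mul_le_of_abs_le_one {s : ℝ} (hs : |s| ≤ 1) (y : ℝ) :
    Real.exp (s * y) ≤ 1 + s * y + s ^ 2 * Real.exp (y ^ 2) := by
  have h1 := exp_le_one_add_add_sq_mul_exp_abs (s * y)
  have h2 : |s * y| ≤ |y| := by
    rw [abs_mul]; exact mul_le_of_le_one_left (abs_nonneg y) hs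
  have h3 := sq_div_two_mul_exp_le_exp_sq |y|
  rw [sq_abs] at h3
  have h4 : (s * y) ^ 2 / 2 * Real.exp |s * y| ≤ s ^ 2 * (y ^ 2 / 2 * Real.exp |y|) := by
    rw [show (s * y) ^ 2 / 2 * Real.exp |s * y| = s ^ 2 * (y ^ 2 / 2 * Real.exp |s * y|) by ring]
    gcongr
  have h5 : s ^ 2 * (y ^ 2 / 2 * Real.exp |y|) ≤ s ^ 2 * Real.exp (y ^ 2) :=
    mul_le_mul_of_nonneg_left h3 (sq_nonneg s)
  linarith

/-- The sub-exponential counterpart: since `θ ≤ 1/2`, half of the exponent in `exp x` is left to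
absorb the factor `x²`. -/
theorem exp_mul_le_of_le_half {θ x : ℝ} (hθ : 0 ≤ θ) (hθ' : θ ≤ 1 / 2) (hx : 0 ≤ x) :
    Real.exp (θ * x) ≤ 1 + θ * x + 4 * θ ^ 2 * Real.exp x := by
  have h1 := exp_le_one_add_add_sq_mul_exp_abs (θ * x)
  rw [abs_of_nonneg (mul_nonneg hθ hx)] at h1
  have h2 : Real.exp (θ * x) ≤ Real.exp (x / 2) := Real.exp_le_exp.2 (by nlinarith)
  have h3 : 1 + x / 2 + (x / 2) ^ 2 / 2 ≤ Real.exp (x / 2) :=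
    Real.quadratic_le_exp_of_nonneg (by linarith)
  have h4 : x ^ 2 / 2 ≤ 4 * Real.exp (x / 2) := by nlinarith
  have h5 : Real.exp (x / 2) * Real.exp (x / 2) = Real.exp x := by
    rw [← Real.exp_add]; congr 1; ring
  have h6 : x ^ 2 / 2 * Real.exp (θ * x) ≤ 4 * Real.exp x := by
    calc x ^ 2 / 2 * Real.exp (θ * x) ≤ (4 * Real.exp (x / 2)) * Real.exp (x / 2) := by
          gcongr
      _ = _ := by rw [mul_assoc, h5]
  have h7 := mul_le_mul_of_nonneg_left h6 (sq_nonneg θ)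
  nlinarith

/-! Orlicz norms and moment generating functions -/

section Orlicz

variable {Ω : Type*} [MeasurableSpace Ω]

/-- Some admissible constant lies below `c`, and the integrand decreases in the constant. Taking `c
> σ` avoids asking whether the infimum is attained; later bounds let `c` decrease to `σ`. -/
theorem lintegral_exp_sub_one_le_of_orliczNorm_le {α σ c : ℝ} {X : Ω → ℝ} {P : Measure Ω}
    (hα : 0 ≤ α) (hX : orliczNorm α X P ≤ ENNReal.ofReal σ) (hc : 0 < c) (hσ : σ < c) :
    ∫⁻ ω, ENNReal.ofReal (Real.exp ((|X ω| / c) ^ α) - 1) ∂P ≤ 1 := by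
  have hlt : orliczNorm α X P < ENNReal.ofReal c :=
    hX.trans_lt ((ENNReal.ofReal_lt_ofReal_iff hc).2 hσ)
  simp only [orliczNorm, iInf_lt_iff] at hlt
  obtain ⟨b, hb, hle, hbc⟩ := hlt
  have hbc' : b < c := (ENNReal.ofReal_lt_ofReal_iff hc).1 hbc
  refine le_trans (lintegral_mono fun ω => ?_) hle
  gcongr

theorem integral_exp_sq_le_two {σ c : ℝ} {X : Ω → ℝ} {P : Measure Ω} [IsProbabilityMeasure P]
    (hXm : AEMeasurable X P) (hX : orliczNorm 2 X P ≤ ENNReal.ofReal σ) (hc : 0 < c)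
    (hσ : σ < c) :
    Integrable (fun ω => Real.exp ((X ω / c) ^ 2)) P ∧
      ∫ ω, Real.exp ((X ω / c) ^ 2) ∂P ≤ 2 := by
  have h := lintegral_exp_sub_one_le_of_orliczNorm_le (by norm_num) hX hc hσ
  have heq : ∀ ω, (|X ω| / c) ^ (2 : ℝ) = (X ω / c) ^ 2 := by
    intro ω
    rw [Real.rpow_two, div_pow, div_pow, sq_abs]
  simp only [heq] at h
  have hnn : ∀ ω, 0 ≤ Real.exp ((X ω / c) ^ 2) - 1 := fun ω =>
    sub_nonneg.2 (Real.one_le_exp (sq_nonneg _))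
  have hm : AEStronglyMeasurable (fun ω => Real.exp ((X ω / c) ^ 2) - 1) P :=
    ((((hXm.div_const c).pow_const 2).exp).sub_const 1).aestronglyMeasurable
  have hint : Integrable (fun ω => Real.exp ((X ω / c) ^ 2) - 1) P := by
    refine ⟨hm, ?_⟩
    rw [hasFiniteIntegral_iff_ofReal (ae_of_all _ hnn)]
    exact h.trans_lt ENNReal.one_lt_top
  have hle : ∫ ω, (Real.exp ((X ω / c) ^ 2) - 1) ∂P ≤ 1 := by
    rw [integral_eq_lintegral_of_nonneg_ae (ae_of_all _ hnn) hm]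
    exact ENNReal.toReal_le_of_le_ofReal zero_le_one (by simpa using h)
  have hint' : Integrable (fun ω => Real.exp ((X ω / c) ^ 2)) P := by
    refine (hint.add (integrable_const (1 : ℝ))).congr (ae_of_all _ fun ω => ?_)
    simp
  refine ⟨hint', ?_⟩
  rw [integral_sub hint' (integrable_const _)] at hle
  simp at hle
  linarith

theorem integrable_and_integral_one_add_mul_add_mul {f g : Ω → ℝ} {P : Measure Ω}
    [IsProbabilityMeasure P] (hf : Integrable f P) (hg : Integrable g P) (a b : ℝ) :
    Integrable (fun ω => 1 + a * f ω + b * g ω) P ∧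
      ∫ ω, (1 + a * f ω + b * g ω) ∂P = 1 + a * ∫ ω, f ω ∂P + b * ∫ ω, g ω ∂P := by
  have h1 : Integrable (fun ω => 1 + a * f ω) P := (integrable_const _).add (hf.const_mul a)
  refine ⟨h1.add (hg.const_mul b), ?_⟩
  rw [integral_add h1 (hg.const_mul b), integral_add (integrable_const _) (hf.const_mul a),
    integral_const_mul, integral_const_mul]
  simp

theorem lintegral_exp_mul_le_of_integral_exp_sq_le {X : Ω → ℝ} {P : Measure Ω}
    [IsProbabilityMeasure P] {c : ℝ} (hc : 0 < c) (hXm : AEMeasurable X P)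
    (hint : Integrable (fun ω => Real.exp ((X ω / c) ^ 2)) P)
    (hle : ∫ ω, Real.exp ((X ω / c) ^ 2) ∂P ≤ 2) (hmean : ∫ ω, X ω ∂P = 0) (t : ℝ) :
    ∫⁻ ω, ENNReal.ofReal (Real.exp (t * X ω)) ∂P ≤
      ENNReal.ofReal (Real.exp (2 * c ^ 2 * t ^ 2)) := by
  have hXint : Integrable X P := by
    refine (hint.const_mul c).mono' hXm.aestronglyMeasurable (ae_of_all _ fun ω => ?_)
    have h1 := Real.add_one_le_exp ((X ω / c) ^ 2)
    have h2 : |X ω / c| ≤ Real.exp ((X ω / c) ^ 2) := by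
      nlinarith [sq_abs (X ω / c), sq_nonneg (|X ω / c| - 1)]
    rw [abs_div, abs_of_pos hc, div_le_iff₀ hc] at h2
    simpa [mul_comm] using h2
  have key : ∀ (f : Ω → ℝ), Integrable f P → (∀ ω, Real.exp (t * X ω) ≤ f ω) →
      ∫ ω, f ω ∂P ≤ Real.exp (2 * c ^ 2 * t ^ 2) →
      ∫⁻ ω, ENNReal.ofReal (Real.exp (t * X ω)) ∂P ≤
        ENNReal.ofReal (Real.exp (2 * c ^ 2 * t ^ 2)) := by
    intro f hf hb hi
    calc ∫⁻ ω, ENNReal.ofReal (Real.exp (t * X ω)) ∂P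
        ≤ ∫⁻ ω, ENNReal.ofReal (f ω) ∂P :=
          lintegral_mono fun ω => ENNReal.ofReal_le_ofReal (hb ω)
      _ = ENNReal.ofReal (∫ ω, f ω ∂P) :=
          (ofReal_integral_eq_lintegral_ofReal hf
            (ae_of_all _ fun ω => (Real.exp_pos _).le.trans (hb ω))).symm
      _ ≤ _ := ENNReal.ofReal_le_ofReal hi
  -- If `|tc| ≤ 1`, the expansion and the zero mean give `1 + 2(tc)²`. If `|tc| > 1`, use `tX ≤
  -- (tc)²/4 + (X/c)²` and absorb the factor `2` into `exp (7(tc)²/4)`; no centring is needed.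
  have hts : ∀ ω, t * X ω = (t * c) * (X ω / c) := fun ω => by field_simp
  rcases le_or_gt |t * c| 1 with h | h
  · refine key (fun ω => 1 + t * X ω + (t * c) ^ 2 * Real.exp ((X ω / c) ^ 2)) ?_ ?_ ?_
    · exact (integrable_and_integral_one_add_mul_add_mul hXint hint _ _).1
    · intro ω
      have := exp_mul_le_of_abs_le_one h (X ω / c)
      rwa [← hts] at this
    · rw [(integrable_and_integral_one_add_mul_add_mul hXint hint _ _).2, hmean]
      have h1 := Real.add_one_le_exp (2 * c ^ 2 * t ^ 2)
      have h2 := mul_le_mul_of_nonneg_left hle (sq_nonneg (t * c))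
      nlinarith
  · refine key (fun ω => Real.exp ((t * c) ^ 2 / 4) * Real.exp ((X ω / c) ^ 2)) ?_ ?_ ?_
    · exact hint.const_mul _
    · intro ω
      rw [← Real.exp_add]
      refine Real.exp_le_exp.2 ?_
      rw [hts]
      nlinarith [sq_nonneg (t * c / 2 - X ω / c)]
    · rw [integral_const_mul]
      have h1 : 1 ≤ (t * c) ^ 2 := by
        rw [← sq_abs]; nlinarith
      have h2 : (2 : ℝ) ≤ Real.exp ((t * c) ^ 2 * (7 / 4)) := by
        have := Real.add_one_le_exp ((t * c) ^ 2 * (7 / 4))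
        linarith
      calc Real.exp ((t * c) ^ 2 / 4) * ∫ ω, Real.exp ((X ω / c) ^ 2) ∂P
          ≤ Real.exp ((t * c) ^ 2 / 4) * Real.exp ((t * c) ^ 2 * (7 / 4)) := by
            gcongr; linarith
        _ = _ := by rw [← Real.exp_add]; congr 1; ring

/-- A centred variable with `ψ₂`-norm at most `σ` has moment generating function at most
`exp (2 σ² t²)`. -/
theorem lintegral_exp_mul_le_of_orliczNorm_le {X : Ω → ℝ} {P : Measure Ω}
    [IsProbabilityMeasure P] {σ : ℝ} (hσ : 0 ≤ σ) (hXm : AEMeasurable X P)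
    (hX : orliczNorm 2 X P ≤ ENNReal.ofReal σ) (hmean : ∫ ω, X ω ∂P = 0) (t : ℝ) :
    ∫⁻ ω, ENNReal.ofReal (Real.exp (t * X ω)) ∂P ≤
      ENNReal.ofReal (Real.exp (2 * σ ^ 2 * t ^ 2)) := by
  have hcont : Continuous fun c : ℝ => ENNReal.ofReal (Real.exp (2 * c ^ 2 * t ^ 2)) :=
    ENNReal.continuous_ofReal.comp (by fun_prop)
  refine ge_of_tendsto (hcont.continuousWithinAt (s := Set.Ioi σ) (x := σ)) ?_
  filter_upwards [self_mem_nhdsWithin] with c hc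
  have hc' : σ < c := hc
  have h := integral_exp_sq_le_two hXm hX (hσ.trans_lt hc') hc'
  exact lintegral_exp_mul_le_of_integral_exp_sq_le (hσ.trans_lt hc') hXm h.1 h.2 hmean t

/-- The moment generating function bound behind Bernstein's inequality for sub-exponential
variables. -/
theorem lintegral_exp_mul_le_of_integral_exp_le {W : Ω → ℝ} {P : Measure Ω}
    [IsProbabilityMeasure P] (hWm : AEMeasurable W P) (hW : ∀ᵐ ω ∂P, 0 ≤ W ω)
    (hint : Integrable (fun ω => Real.exp (W ω)) P) (hle : ∫ ω, Real.exp (W ω) ∂P ≤ 2)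
    {θ : ℝ} (hθ : 0 ≤ θ) (hθ' : θ ≤ 1 / 2) :
    ∫⁻ ω, ENNReal.ofReal (Real.exp (θ * W ω)) ∂P ≤
      ENNReal.ofReal (Real.exp (θ * ∫ ω, W ω ∂P + 8 * θ ^ 2)) := by
  have hWint : Integrable W P := by
    refine hint.mono' hWm.aestronglyMeasurable ?_
    filter_upwards [hW] with ω h
    rw [Real.norm_of_nonneg h]
    linarith [Real.add_one_le_exp (W ω)]
  have hI := integrable_and_integral_one_add_mul_add_mul hWint hint θ (4 * θ ^ 2)
  calc ∫⁻ ω, ENNReal.ofReal (Real.exp (θ * W ω)) ∂P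
      ≤ ∫⁻ ω, ENNReal.ofReal (1 + θ * W ω + 4 * θ ^ 2 * Real.exp (W ω)) ∂P := by
        refine lintegral_mono_ae ?_
        filter_upwards [hW] with ω h
        exact ENNReal.ofReal_le_ofReal (exp_mul_le_of_le_half hθ hθ' h)
    _ = ENNReal.ofReal (∫ ω, (1 + θ * W ω + 4 * θ ^ 2 * Real.exp (W ω)) ∂P) := by
        refine (ofReal_integral_eq_lintegral_ofReal hI.1 ?_).symm
        filter_upwards [hW] with ω h
        have := Real.exp_pos (W ω)
        simp only [Pi.zero_apply]
        positivity
    _ ≤ _ := by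
        refine ENNReal.ofReal_le_ofReal ?_
        rw [hI.2]
        have h1 := Real.add_one_le_exp (θ * ∫ ω, W ω ∂P + 8 * θ ^ 2)
        have h2 := mul_le_mul_of_nonneg_left hle (by positivity : 0 ≤ 4 * θ ^ 2)
        linarith

end Orlicz

/-! Conditioning a single observation on `(X, T)` -/

section Population

variable {p : ℕ} {ν : Measure (FullData p)} [IsProbabilityMeasure ν]

theorem measurable_obsT : Measurable (obsT : FullData p → Bool) := measurable_fst

theorem measurable_outY : Measurable (outY : FullData p → ℝ) :=
  measurable_fst.comp measurable_snd

theorem measurable_indT : Measurable (indT : FullData p → ℝ) :=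
  Measurable.ite (measurable_obsT (measurableSet_singleton true)) measurable_const
    measurable_const

theorem measurable_err {m : (Fin p → ℝ) → ℝ} (hm : Measurable m) : Measurable (err m) :=
  measurable_outY.sub (hm.comp measurable_covX)

/-- Uniqueness of disintegrations. The tail assumption concerns the law of `ε` given `X`, whereas
ignorability concerns `Y`; this translation links the two. -/
theorem condDistrib_err_ae_eq {m : (Fin p → ℝ) → ℝ} (hm : Measurable m) :
    ∀ᵐ x ∂(ν.map covX), condDistrib (err m) covX ν x =
      (condDistrib outY covX ν x).map (fun y => y - m x) := by
  have hf : Measurable fun z : (Fin p → ℝ) × ℝ => z.2 - m z.1 :=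
    measurable_snd.sub (hm.comp measurable_fst)
  have h := condDistrib_ae_eq_of_measure_eq_compProd_of_measurable (μ := ν)
    (X := covX) (Y := err m)
    (κ := (Kernel.id ×ₖ condDistrib outY covX ν).map (fun z => z.2 - m z.1))
    measurable_covX (measurable_err hm) ?_
  · filter_upwards [h] with x hx
    rw [hx, Kernel.map_apply _ hf, Kernel.prod_apply, Kernel.id_apply, Measure.dirac_prod,
      Measure.map_map hf (by fun_prop)]
    rfl
  · have h2 : ν.map (fun z => (covX z, err m z)) =
        (ν.map (fun z => (covX z, outY z))).map (fun z => (z.1, z.2 - m z.1)) := by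
      rw [Measure.map_map (measurable_fst.prodMk hf) (measurable_covX.prodMk measurable_outY)]
      rfl
    rw [h2, ← compProd_map_condDistrib measurable_outY.aemeasurable]
    refine Measure.ext_of_lintegral _ fun f hfm => ?_
    rw [lintegral_map hfm (measurable_fst.prodMk hf), Measure.lintegral_compProd (by fun_prop),
      Measure.lintegral_compProd hfm]
    refine lintegral_congr fun x => ?_
    rw [Kernel.map_apply _ hf, Kernel.prod_apply, Kernel.id_apply, Measure.dirac_prod,
      Measure.map_map hf (by fun_prop), lintegral_map (by fun_prop) (by fun_prop)]
    rfl

theorem integral_condDistrib_err_eq_zero {m : (Fin p → ℝ) → ℝ} (hm : IsOutcomeRegression ν m) :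
    ∀ᵐ x ∂(ν.map covX), ∫ e, e ∂(condDistrib (err m) covX ν x) = 0 := by
  obtain ⟨hY, hmm, hcond⟩ := hm
  have hX : Integrable (fun z => m (covX z)) ν := integrable_condExp.congr hcond.symm
  have hint : Integrable (err m) ν := hY.sub hX
  have h1 := condExp_ae_eq_integral_condDistrib' measurable_covX hint
  have h2 : ν[err m | sigmaX p] =ᵐ[ν] 0 := by
    have h3 := condExp_sub hY hX (sigmaX p)
    have h4 : ν[fun z => m (covX z) | sigmaX p] = fun z => m (covX z) :=
      condExp_of_stronglyMeasurable (sigmaX_le p)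
        (hmm.stronglyMeasurable.comp_measurable (comap_measurable covX)) hX
    refine h3.trans ?_
    rw [h4]
    filter_upwards [hcond] with z hz
    simp [hz]
  have h3 : ∀ᵐ z ∂ν, ∫ e, e ∂(condDistrib (err m) covX ν (covX z)) = 0 := by
    filter_upwards [h1, h2] with z hz1 hz2
    rw [← hz1, hz2]; rfl
  have hmeas : MeasurableSet {x | ∫ e, e ∂(condDistrib (err m) covX ν x) = 0} :=
    (stronglyMeasurable_id.integral_kernel).measurable (measurableSet_singleton 0)
  exact (ae_map_iff measurable_covX.aemeasurable hmeas).2 h3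

/-- The null set does not depend on `b`, so `b` may later be a function of `(T, X)`. -/
theorem lintegral_condDistrib_exp_err_le {d : ℕ} {m : (Fin p → ℝ) → ℝ}
    {h : (Fin p → ℝ) → Fin d → ℝ} {σε σh : ℝ} (hm : IsOutcomeRegression ν m)
    (hs : SubGaussianAssumptions ν m h σε σh) :
    ∀ᵐ x ∂(ν.map covX), ∀ b : ℝ,
      ∫⁻ y, ENNReal.ofReal (Real.exp (b * (y - m x))) ∂(condDistrib outY covX ν x) ≤
        ENNReal.ofReal (Real.exp (2 * σε ^ 2 * b ^ 2)) := by
  obtain ⟨s, _, hsx⟩ := hs.err_cond_subGaussian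
  filter_upwards [hsx, condDistrib_err_ae_eq (ν := ν) hm.2.1, integral_condDistrib_err_eq_zero hm]
    with x ⟨_, h1, h2⟩ h3 h4 b
  have h5 := lintegral_exp_mul_le_of_orliczNorm_le (P := condDistrib (err m) covX ν x)
    (X := fun e => e) hs.sigma_err_nonneg aemeasurable_id
    (h2.trans (ENNReal.ofReal_le_ofReal h1)) h4 b
  rw [h3, lintegral_map (by fun_prop) (by fun_prop)] at h5
  exact h5

/-- Ignorability in kernel form: the conditional law of `Y` given `(X, T)` ignores `T`. -/
theorem map_covX_obsT_outY {π : (Fin p → ℝ) → ℝ} {δ : ℝ} (hb : BasicAssumptions ν π δ) :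
    ν.map (fun z => ((covX z, obsT z), outY z)) =
      (ν.map fun z => (covX z, obsT z)) ⊗ₘ (condDistrib outY covX ν).prodMkRight Bool := by
  have h := (condIndepFun_iff_condDistrib_prod_ae_eq_prodMkRight (μ := ν) measurable_outY
    measurable_obsT measurable_covX).1 hb.ignorability
  rw [← compProd_map_condDistrib measurable_outY.aemeasurable, Measure.compProd_congr h]

/-- Conditionally on `(X, T)`, the error has a sub-Gaussian moment generating function. -/
theorem lintegral_mul_exp_err_le {d : ℕ} {π m : (Fin p → ℝ) → ℝ}
    {h : (Fin p → ℝ) → Fin d → ℝ} {δ σε σh : ℝ} (hb : BasicAssumptions ν π δ)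
    (hm : IsOutcomeRegression ν m) (hs : SubGaussianAssumptions ν m h σε σh)
    {g : Bool × (Fin p → ℝ) → ℝ≥0∞} {b : Bool × (Fin p → ℝ) → ℝ} (hg : Measurable g)
    (hbm : Measurable b) :
    ∫⁻ z, g (obsT z, covX z) * ENNReal.ofReal (Real.exp (b (obsT z, covX z) * err m z)) ∂ν ≤
      ∫⁻ z, g (obsT z, covX z) *
        ENNReal.ofReal (Real.exp (2 * σε ^ 2 * b (obsT z, covX z) ^ 2)) ∂ν := by
  have hmm := hm.2.1
  have hXT : Measurable fun z : FullData p => (covX z, obsT z) :=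
    measurable_covX.prodMk measurable_obsT
  have hF : Measurable fun w : ((Fin p → ℝ) × Bool) × ℝ => g (w.1.2, w.1.1) *
      ENNReal.ofReal (Real.exp (b (w.1.2, w.1.1) * (w.2 - m w.1.1))) := by fun_prop
  have hG : Measurable fun w : (Fin p → ℝ) × Bool => g (w.2, w.1) *
      ENNReal.ofReal (Real.exp (2 * σε ^ 2 * b (w.2, w.1) ^ 2)) := by fun_prop
  have h1 := lintegral_map (μ := ν) hF (hXT.prodMk measurable_outY)
  have h2 := lintegral_map (μ := ν) hG hXT
  rw [map_covX_obsT_outY hb, Measure.lintegral_compProd hF] at h1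
  calc _ = _ := h1.symm
    _ ≤ _ := ?_
    _ = _ := h2
  refine lintegral_mono_ae ?_
  have h3 : ∀ᵐ w ∂(ν.map fun z => (covX z, obsT z)), ∀ b : ℝ,
      ∫⁻ y, ENNReal.ofReal (Real.exp (b * (y - m w.1))) ∂(condDistrib outY covX ν w.1) ≤
        ENNReal.ofReal (Real.exp (2 * σε ^ 2 * b ^ 2)) := by
    have h4 := lintegral_condDistrib_exp_err_le hm hs
    have h5 : ν.map covX = (ν.map fun z => (covX z, obsT z)).map Prod.fst := by
      rw [Measure.map_map measurable_fst hXT]; rfl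
    rw [h5] at h4
    exact ae_of_ae_map measurable_fst.aemeasurable h4
  filter_upwards [h3] with w hw
  simp only [Kernel.prodMkRight_apply]
  rw [lintegral_const_mul _ (by fun_prop)]
  gcongr
  exact hw _

/-! Conditioning a sample on the pairs `(T_i, X_i)` -/

variable {n : ℕ}

/-- The pairs `(T_i, X_i)` of a sample. -/
def obsPairs (z : Fin n → FullData p) : Fin n → Bool × (Fin p → ℝ) :=
  fun i => (obsT (z i), covX (z i))

theorem measurable_obsPairs :
    Measurable (obsPairs : (Fin n → FullData p) → Fin n → Bool × (Fin p → ℝ)) :=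
  measurable_pi_lambda _ fun i => (measurable_obsT.comp (measurable_pi_apply i)).prodMk
    (measurable_covX.comp (measurable_pi_apply i))

theorem obsPairs_update (z : Fin n → FullData p) (i : Fin n) (w : FullData p) :
    obsPairs (Function.update z i w) =
      Function.update (obsPairs z) i (obsT w, covX w) := by
  ext1 k
  by_cases hk : k = i
  · subst hk; simp [obsPairs]
  · simp [obsPairs, hk]

/-- Errors are integrated out one observation at a time. The factor `F` is arbitrary so that the
bound obtained for one error, a function of the pairs alone, can be absorbed into it before the next
error is treated. -/
theorem lintegral_pi_mul_prod_exp_err_le {d : ℕ} {π m : (Fin p → ℝ) → ℝ}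
    {h : (Fin p → ℝ) → Fin d → ℝ} {δ σε σh : ℝ} (hb : BasicAssumptions ν π δ)
    (hm : IsOutcomeRegression ν m) (hs : SubGaussianAssumptions ν m h σε σh)
    {b : Fin n → (Fin n → Bool × (Fin p → ℝ)) → ℝ} (hbm : ∀ i, Measurable (b i))
    (s : Finset (Fin n)) :
    ∀ {F : (Fin n → Bool × (Fin p → ℝ)) → ℝ≥0∞}, Measurable F →
    ∫⁻ z, F (obsPairs z) *
        ∏ i ∈ s, ENNReal.ofReal (Real.exp (b i (obsPairs z) * err m (z i)))
        ∂(Measure.pi fun _ => ν) ≤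
      ∫⁻ z, F (obsPairs z) *
        ∏ i ∈ s, ENNReal.ofReal (Real.exp (2 * σε ^ 2 * b i (obsPairs z) ^ 2))
        ∂(Measure.pi fun _ => ν) := by
  have hobs := measurable_obsPairs (n := n) (p := p)
  have herr : ∀ i, Measurable fun z : Fin n → FullData p => err m (z i) := fun i =>
    (measurable_err hm.2.1).comp (measurable_pi_apply i)
  have hbo : ∀ i, Measurable fun z : Fin n → FullData p => b i (obsPairs z) := fun i =>
    (hbm i).comp hobs
  induction s using Finset.induction_on with
  | empty => intro F _; simp
  | insert a s ha ih =>
    intro F hF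
    have hFo : Measurable fun z : Fin n → FullData p => F (obsPairs z) := hF.comp hobs
    have hprod : Measurable fun z : Fin n → FullData p =>
        ∏ i ∈ s, ENNReal.ofReal (Real.exp (b i (obsPairs z) * err m (z i))) := by
      refine Finset.measurable_prod _ fun i _ => ?_
      have := hbo i; have := herr i
      fun_prop
    have hba := hbo a
    have hea := herr a
    have hF' : Measurable fun D : Fin n → Bool × (Fin p → ℝ) =>
        F D * ENNReal.ofReal (Real.exp (2 * σε ^ 2 * b a D ^ 2)) := by
      have := hbm a
      fun_prop
    calc _ ≤ ∫⁻ z, (F (obsPairs z) *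
            ENNReal.ofReal (Real.exp (2 * σε ^ 2 * b a (obsPairs z) ^ 2))) *
          ∏ i ∈ s, ENNReal.ofReal (Real.exp (b i (obsPairs z) * err m (z i)))
          ∂(Measure.pi fun _ => ν) := ?_
      _ ≤ _ := ih hF'
      _ = _ := by
        refine lintegral_congr fun z => ?_
        rw [Finset.prod_insert ha, mul_assoc]
    simp only [Finset.prod_insert ha]
    refine lintegral_le_of_lmarginal_le (s := {a}) (by fun_prop) (by fun_prop) fun z => ?_
    rw [lmarginal_singleton, lmarginal_singleton]
    have hup : Measurable fun D : Bool × (Fin p → ℝ) => Function.update (obsPairs z) a D :=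
      measurable_update _
    -- With the other observations fixed, the remaining weights still vary with the pair at `a`, but
    -- not with its error, so they all belong in `g`.
    have hstep := lintegral_mul_exp_err_le hb hm hs
      (g := fun D => F (Function.update (obsPairs z) a D) *
        ∏ i ∈ s, ENNReal.ofReal (Real.exp (b i (Function.update (obsPairs z) a D) *
          err m (z i))))
      (b := fun D => b a (Function.update (obsPairs z) a D))
      (by
        refine (hF.comp hup).mul (Finset.measurable_prod _ fun i _ => ?_)
        have : Measurable fun D => b i (Function.update (obsPairs z) a D) := (hbm i).comp hup
        fun_prop)
      ((hbm a).comp hup)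
    have hne : ∀ w : FullData p, ∀ i ∈ s, Function.update z a w i = z i := fun w i hi =>
      Function.update_of_ne (ne_of_mem_of_not_mem hi ha) _ _
    have hpr : ∀ (w : FullData p) (D : Fin n → Bool × (Fin p → ℝ)),
        ∏ i ∈ s, ENNReal.ofReal (Real.exp (b i D * err m (Function.update z a w i))) =
        ∏ i ∈ s, ENNReal.ofReal (Real.exp (b i D * err m (z i))) := fun w D =>
      Finset.prod_congr rfl fun i hi => by rw [hne w i hi]
    simp only [hpr, Function.update_self, obsPairs_update]
    refine le_trans (le_of_eq ?_) (hstep.trans (le_of_eq ?_))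
    · exact lintegral_congr fun w => by ring
    · exact lintegral_congr fun w => by ring

end Population

/-! Chernoff bounds -/

section Chernoff

variable {Ω : Type*} [MeasurableSpace Ω] {μ : Measure Ω} {S : Ω → ℝ}

/-- Continuity from below. Working at thresholds strictly above `a` keeps the Chernoff parameters
finite when the scale (`w` or `K₀` below) is zero. -/
theorem measure_inter_lt_le_of_forall_gt {E : Set Ω} {a : ℝ} {r : ℝ≥0∞}
    (h : ∀ b, a < b → μ (E ∩ {ω | b < S ω}) ≤ r) : μ (E ∩ {ω | a < S ω}) ≤ r := by
  have hU : E ∩ {ω | a < S ω} = ⋃ k : ℕ, E ∩ {ω | a + 1 / ((k : ℝ) + 1) < S ω} := by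
    ext ω
    simp only [Set.mem_inter_iff, Set.mem_ofPred_eq, Set.mem_iUnion]
    constructor
    · rintro ⟨hE, hω⟩
      obtain ⟨k, hk⟩ := exists_nat_one_div_lt (sub_pos.2 hω)
      exact ⟨k, hE, by linarith⟩
    · rintro ⟨k, hE, hk⟩
      have : (0 : ℝ) < 1 / ((k : ℝ) + 1) := Nat.one_div_pos_of_nat
      exact ⟨hE, by linarith⟩
  have hmono : Monotone fun k : ℕ => E ∩ {ω | a + 1 / ((k : ℝ) + 1) < S ω} := by
    intro k l hkl ω hω
    have h1 : 1 / ((l : ℝ) + 1) ≤ 1 / ((k : ℝ) + 1) := Nat.one_div_le_one_div hkl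
    have h2 : a + 1 / ((k : ℝ) + 1) < S ω := hω.2
    exact ⟨hω.1, lt_of_le_of_lt (by linarith) h2⟩
  rw [hU, hmono.measure_iUnion]
  exact iSup_le fun k => h _ (lt_add_of_pos_right a Nat.one_div_pos_of_nat)

theorem measure_inter_lt_le_exp (hS : Measurable S) {E : Set Ω} (hE : MeasurableSet E)
    {t K : ℝ} (ht : 0 ≤ t)
    (h : ∫⁻ ω in E, ENNReal.ofReal (Real.exp (t * S ω)) ∂μ ≤ ENNReal.ofReal (Real.exp K))
    (a : ℝ) : μ (E ∩ {ω | a < S ω}) ≤ ENNReal.ofReal (Real.exp (K - t * a)) := by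
  have h1 := mul_meas_ge_le_lintegral (μ := μ.restrict E)
    (f := fun ω => ENNReal.ofReal (Real.exp (t * S ω))) (by fun_prop)
    (ENNReal.ofReal (Real.exp (t * a)))
  have h2 : μ (E ∩ {ω | a < S ω}) ≤
      μ.restrict E {ω | ENNReal.ofReal (Real.exp (t * a)) ≤
        ENNReal.ofReal (Real.exp (t * S ω))} := by
    rw [Measure.restrict_apply' hE, Set.inter_comm]
    refine measure_mono (Set.inter_subset_inter_left _ fun ω hω => ?_)
    have hω' : a < S ω := hω
    exact ENNReal.ofReal_le_ofReal (Real.exp_le_exp.2 (mul_le_mul_of_nonneg_left hω'.le ht))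
  have h3 : ENNReal.ofReal (Real.exp (t * a)) * μ (E ∩ {ω | a < S ω}) ≤
      ENNReal.ofReal (Real.exp K) := (mul_le_mul_right h2 _).trans (h1.trans h)
  have hpos : ENNReal.ofReal (Real.exp (t * a)) ≠ 0 := by
    simpa using Real.exp_pos (t * a)
  rw [mul_comm] at h3
  refine (ENNReal.le_div_iff_mul_le (Or.inl hpos) (Or.inl ENNReal.ofReal_ne_top)).2 h3 |>.trans ?_
  rw [← ENNReal.ofReal_div_of_pos (Real.exp_pos _), ← Real.exp_sub]

/-- The Chernoff bound for a variable with sub-Gaussian moment generating function on a set,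
including the degenerate case `w = 0`. -/
theorem measure_inter_sqrt_lt_le_exp (hS : Measurable S) {E : Set Ω} (hE : MeasurableSet E)
    {w s : ℝ} (hw : 0 ≤ w) (hs : 0 ≤ s)
    (h : ∀ t : ℝ, ∫⁻ ω in E, ENNReal.ofReal (Real.exp (t * S ω)) ∂μ ≤
      ENNReal.ofReal (Real.exp (2 * w * t ^ 2))) :
    μ (E ∩ {ω | s * √(8 * w) < S ω}) ≤ ENNReal.ofReal (Real.exp (-s ^ 2)) := by
  refine measure_inter_lt_le_of_forall_gt fun b hb => ?_
  have hb0 : 0 < b := lt_of_le_of_lt (by positivity) hb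
  -- With `t = 2s²/b` the exponent is `s² · (8ws²/b²) - 2s²`, and `8ws² ≤ b²`.
  refine (measure_inter_lt_le_exp hS hE (by positivity) (h (2 * s ^ 2 / b)) b).trans
    (ENNReal.ofReal_le_ofReal (Real.exp_le_exp.2 ?_))
  have hsq : s ^ 2 * (8 * w) ≤ b ^ 2 := by
    have h1 : (s * √(8 * w)) ^ 2 ≤ b ^ 2 := by gcongr
    rwa [mul_pow, Real.sq_sqrt (by positivity)] at h1
  have h2 : 2 * w * (2 * s ^ 2 / b) ^ 2 = s ^ 2 * (s ^ 2 * (8 * w) / b ^ 2) := by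
    field_simp; ring
  have h3 : 2 * s ^ 2 / b * b = 2 * s ^ 2 := by field_simp
  have h4 : s ^ 2 * (8 * w) / b ^ 2 ≤ 1 := (div_le_one (by positivity)).2 hsq
  rw [h2, h3]
  nlinarith [mul_le_mul_of_nonneg_left h4 (sq_nonneg s)]

end Chernoff

/-! ### Tail bounds for weighted errors and for sub-exponential sums -/

section Population

variable {p d n : ℕ} {ν : Measure (FullData p)} [IsProbabilityMeasure ν]

/-- Weighted sums of the errors, with weights computed from the pairs `(T_i, X_i)`, have
sub-Gaussian upper tails. -/
theorem pi_measure_sqrt_lt_sum_err_le {π m : (Fin p → ℝ) → ℝ}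
    {h : (Fin p → ℝ) → Fin d → ℝ} {δ σε σh : ℝ} (hb : BasicAssumptions ν π δ)
    (hm : IsOutcomeRegression ν m) (hs : SubGaussianAssumptions ν m h σε σh)
    {b : Fin n → (Fin n → Bool × (Fin p → ℝ)) → ℝ} (hbm : ∀ i, Measurable (b i))
    {G : Set (Fin n → Bool × (Fin p → ℝ))} (hG : MeasurableSet G) {V s : ℝ} (hV : 0 ≤ V)
    (hs0 : 0 ≤ s) (hGV : ∀ D ∈ G, ∑ i, b i D ^ 2 ≤ V) :
    (Measure.pi fun _ : Fin n => ν) (obsPairs ⁻¹' G ∩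
        {z | s * √(8 * (σε ^ 2 * V)) < ∑ i, b i (obsPairs z) * err m (z i)}) ≤
      ENNReal.ofReal (Real.exp (-s ^ 2)) := by
  have hobs := measurable_obsPairs (n := n) (p := p)
  have hE : MeasurableSet ((obsPairs (n := n) (p := p)) ⁻¹' G) := hobs hG
  refine measure_inter_sqrt_lt_le_exp ?_ hE (by positivity) hs0 fun t => ?_
  · refine Finset.measurable_sum _ fun i _ => ((hbm i).comp hobs).mul
      ((measurable_err hm.2.1).comp (measurable_pi_apply i))
  rw [← lintegral_indicator hE]
  -- The restriction to `G` enters through `F`, the indicator of a condition on the pairs.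
  have hstep := lintegral_pi_mul_prod_exp_err_le hb hm hs (b := fun i D => t * b i D)
    (fun i => (hbm i).const_mul t) Finset.univ (F := G.indicator 1)
    (measurable_one.indicator hG)
  refine le_trans (le_of_eq ?_) (hstep.trans ?_)
  · refine lintegral_congr fun z => ?_
    rw [← ENNReal.ofReal_prod_of_nonneg fun _ _ => (Real.exp_pos _).le, ← Real.exp_sum]
    by_cases hz : obsPairs z ∈ G
    · simp [Set.indicator, hz, mul_assoc, Finset.mul_sum]
    · simp [Set.indicator, hz]
  · calc _ ≤ ∫⁻ _ : Fin n → FullData p, ENNReal.ofReal (Real.exp (2 * (σε ^ 2 * V) * t ^ 2))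
          ∂(Measure.pi fun _ => ν) := ?_
      _ = _ := by simp
    refine lintegral_mono fun z => ?_
    rw [← ENNReal.ofReal_prod_of_nonneg fun _ _ => (Real.exp_pos _).le, ← Real.exp_sum]
    by_cases hz : obsPairs z ∈ G
    · simp only [Set.indicator, hz, if_true, Pi.one_apply, one_mul]
      refine ENNReal.ofReal_le_ofReal (Real.exp_le_exp.2 ?_)
      have h1 : ∑ i, 2 * σε ^ 2 * (t * b i (obsPairs z)) ^ 2 =
          2 * σε ^ 2 * t ^ 2 * ∑ i, b i (obsPairs z) ^ 2 := by
        rw [Finset.mul_sum]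
        exact Finset.sum_congr rfl fun i _ => by ring
      rw [h1]
      have h2 := mul_le_mul_of_nonneg_left (hGV _ hz)
        (by positivity : 0 ≤ 2 * σε ^ 2 * t ^ 2)
      linarith
    · simp [Set.indicator, hz]

theorem pi_measure_sqrt_lt_abs_sum_err_le {π m : (Fin p → ℝ) → ℝ}
    {h : (Fin p → ℝ) → Fin d → ℝ} {δ σε σh : ℝ} (hb : BasicAssumptions ν π δ)
    (hm : IsOutcomeRegression ν m) (hs : SubGaussianAssumptions ν m h σε σh)
    {b : Fin n → (Fin n → Bool × (Fin p → ℝ)) → ℝ} (hbm : ∀ i, Measurable (b i))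
    {G : Set (Fin n → Bool × (Fin p → ℝ))} (hG : MeasurableSet G) {V s : ℝ} (hV : 0 ≤ V)
    (hs0 : 0 ≤ s) (hGV : ∀ D ∈ G, ∑ i, b i D ^ 2 ≤ V) :
    (Measure.pi fun _ : Fin n => ν) (obsPairs ⁻¹' G ∩
        {z | s * √(8 * (σε ^ 2 * V)) < |∑ i, b i (obsPairs z) * err m (z i)|}) ≤
      ENNReal.ofReal (2 * Real.exp (-s ^ 2)) := by
  have h1 := pi_measure_sqrt_lt_sum_err_le hb hm hs hbm hG hV hs0 hGV
  have h2 := pi_measure_sqrt_lt_sum_err_le hb hm hs (fun i => (hbm i).neg) hG hV hs0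
    (fun D hD => by simpa using hGV D hD)
  rw [two_mul, ENNReal.ofReal_add (Real.exp_pos _).le (Real.exp_pos _).le]
  refine (measure_mono ?_).trans ((measure_union_le _ _).trans (add_le_add h1 h2))
  rintro z ⟨hz, hzs⟩
  have hzs' : s * √(8 * (σε ^ 2 * V)) < |∑ i, b i (obsPairs z) * err m (z i)| := hzs
  rcases lt_abs.1 hzs' with h3 | h3
  · exact Or.inl ⟨hz, h3⟩
  · refine Or.inr ⟨hz, ?_⟩
    simpa using h3

/-- Bernstein's inequality (upper tail) for nonnegative sub-exponential variables. -/
theorem pi_measure_lt_sum_le_exp (hn : 1 ≤ n) {W : FullData p → ℝ} (hWm : Measurable W)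
    (hW : ∀ᵐ z ∂ν, 0 ≤ W z) {K₀ e : ℝ} (hK₀ : 0 ≤ K₀)
    (hK : ∀ K, K₀ < K → Integrable (fun z => Real.exp (W z / K)) ν ∧
      ∫ z, Real.exp (W z / K) ∂ν ≤ 2) (he : 0 < e) (he1 : e ≤ 1) :
    (Measure.pi fun _ : Fin n => ν) {z | n * (∫ z, W z ∂ν + 6 * K₀ * e) < ∑ i, W (z i)} ≤
      ENNReal.ofReal (Real.exp (-(n * e ^ 2))) := by
  have hn0 : (0 : ℝ) < n := by exact_mod_cast hn
  have hSm : Measurable fun z : Fin n → FullData p => ∑ i, W (z i) :=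
    Finset.measurable_sum _ fun i _ => hWm.comp (measurable_pi_apply i)
  rw [← Set.univ_inter {z : Fin n → FullData p | _ < _}]
  refine measure_inter_lt_le_of_forall_gt fun a ha => ?_
  set I := ∫ z, W z ∂ν with hI
  -- The scale for which `a` is exactly the Bernstein threshold; `a` lies above the original
  -- threshold, so `K > K₀`.
  set K := (a / n - I) / (6 * e) with hKdef
  have ha' : a = n * (I + 6 * K * e) := by rw [hKdef]; field_simp; ring
  have hKgt : K₀ < K := by
    rw [ha', mul_lt_mul_iff_right₀ hn0] at ha
    have h1 : 6 * K₀ * e < 6 * K * e := by linarith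
    have h2 := lt_of_mul_lt_mul_right h1 he.le
    linarith
  have hKpos : 0 < K := hK₀.trans_lt hKgt
  obtain ⟨hint, hle⟩ := hK K hKgt
  -- With `θ = e/2` the means cancel and the Chernoff exponent is `n(2e² - 3e²) = -ne²`; `e ≤ 1` is
  -- what makes `θ ≤ 1/2`.
  have hmgf := lintegral_exp_mul_le_of_integral_exp_le (W := fun z => W z / K) (P := ν)
    (hWm.div_const K).aemeasurable (hW.mono fun z hz => div_nonneg hz hKpos.le) hint hle
    (θ := e / 2) (by positivity) (by linarith)
  rw [integral_div, ← hI] at hmgf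
  have hprod : ∫⁻ z in Set.univ, ENNReal.ofReal (Real.exp (e / 2 / K * ∑ i, W (z i)))
      ∂(Measure.pi fun _ : Fin n => ν) ≤
      ENNReal.ofReal (Real.exp (n * (e / 2 * (I / K) + 8 * (e / 2) ^ 2))) := by
    have hg : Measurable fun z => ENNReal.ofReal (Real.exp (e / 2 * (W z / K))) := by fun_prop
    have hind := lintegral_prod_eq_prod_lintegral_of_indepFun
      (μ := Measure.pi fun _ : Fin n => ν) Finset.univ
      (fun i z => ENNReal.ofReal (Real.exp (e / 2 * (W (z i) / K))))
      (iIndepFun_pi (fun _ => hg.aemeasurable)) (fun i => hg.comp (measurable_pi_apply i))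
    rw [Measure.restrict_univ]
    calc _ = ∫⁻ z, ∏ i, ENNReal.ofReal (Real.exp (e / 2 * (W (z i) / K)))
          ∂(Measure.pi fun _ : Fin n => ν) := by
          refine lintegral_congr fun z => ?_
          rw [← ENNReal.ofReal_prod_of_nonneg fun _ _ => (Real.exp_pos _).le, ← Real.exp_sum,
            Finset.mul_sum]
          congr 2
          exact Finset.sum_congr rfl fun i _ => by ring
      _ = ∏ i : Fin n, ∫⁻ z, ENNReal.ofReal (Real.exp (e / 2 * (W z / K))) ∂ν := by
          rw [hind]
          exact Finset.prod_congr rfl fun i _ =>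
            (measurePreserving_eval (fun _ : Fin n => ν) i).lintegral_comp hg
      _ ≤ ∏ _i : Fin n, ENNReal.ofReal (Real.exp (e / 2 * (I / K) + 8 * (e / 2) ^ 2)) :=
          Finset.prod_le_prod' fun _ _ => hmgf
      _ = _ := by
          rw [Finset.prod_const, Finset.card_univ, Fintype.card_fin,
            ← ENNReal.ofReal_pow (Real.exp_pos _).le, ← Real.exp_nat_mul]
  refine (measure_inter_lt_le_exp hSm MeasurableSet.univ (by positivity) hprod a).trans
    (le_of_eq ?_)
  congr 2
  rw [ha']
  field_simp
  ring

/-! The inverse-probability-weighted second moments -/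

/-- Integrate `x² ≤ c² (exp (x²/c²) - 1)` for `c > σ`, then let `c` decrease to `σ`. -/
theorem integral_sq_le_of_orliczNorm_le {Ω : Type*} [MeasurableSpace Ω] {P : Measure Ω}
    [IsProbabilityMeasure P] {X : Ω → ℝ} {σ : ℝ} (hσ : 0 ≤ σ) (hXm : AEMeasurable X P)
    (hX : orliczNorm 2 X P ≤ ENNReal.ofReal σ) :
    Integrable (fun ω => X ω ^ 2) P ∧ ∫ ω, X ω ^ 2 ∂P ≤ σ ^ 2 := by
  have key : ∀ c, σ < c → Integrable (fun ω => X ω ^ 2) P ∧ ∫ ω, X ω ^ 2 ∂P ≤ c ^ 2 := by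
    intro c hc
    have hc0 := hσ.trans_lt hc
    obtain ⟨h1, h2⟩ := integral_exp_sq_le_two hXm hX hc0 hc
    have hI : Integrable (fun ω => c ^ 2 * (Real.exp ((X ω / c) ^ 2) - 1)) P :=
      (h1.sub (integrable_const 1)).const_mul _
    have hle : ∀ ω, X ω ^ 2 ≤ c ^ 2 * (Real.exp ((X ω / c) ^ 2) - 1) := by
      intro ω
      have h3 := Real.add_one_le_exp ((X ω / c) ^ 2)
      calc X ω ^ 2 = c ^ 2 * (X ω / c) ^ 2 := by field_simp
        _ ≤ _ := by gcongr; linarith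
    have hXI : Integrable (fun ω => X ω ^ 2) P :=
      hI.mono' (hXm.pow_const 2).aestronglyMeasurable (ae_of_all _ fun ω => by
        rw [Real.norm_of_nonneg (sq_nonneg _)]; exact hle ω)
    refine ⟨hXI, (integral_mono hXI hI hle).trans ?_⟩
    rw [integral_const_mul, integral_sub h1 (integrable_const _)]
    simp
    nlinarith [sq_nonneg c]
  refine ⟨(key (σ + 1) (by linarith)).1, ?_⟩
  refine ge_of_tendsto ((continuous_pow 2).continuousWithinAt (s := Set.Ioi σ) (x := σ)) ?_
  filter_upwards [self_mem_nhdsWithin] with c hc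
  exact (key c hc).2

/-- `T h_j(X)² / π(X)²`. -/
noncomputable def weightedSq (π : (Fin p → ℝ) → ℝ) (h : (Fin p → ℝ) → Fin d → ℝ) (j : Fin d)
    (z : FullData p) : ℝ :=
  indT z * ((h (covX z) j) ^ 2 / π (covX z) ^ 2)

theorem indT_nonneg (z : FullData p) : 0 ≤ indT z := by
  unfold indT; split_ifs <;> norm_num

theorem indT_le_one (z : FullData p) : indT z ≤ 1 := by
  unfold indT; split_ifs <;> norm_num

theorem weightedSq_nonneg (π : (Fin p → ℝ) → ℝ) (h : (Fin p → ℝ) → Fin d → ℝ) (j : Fin d)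
    (z : FullData p) : 0 ≤ weightedSq π h j z :=
  mul_nonneg (indT_nonneg z) (by positivity)

theorem measurable_weightedSq {π : (Fin p → ℝ) → ℝ} {h : (Fin p → ℝ) → Fin d → ℝ}
    (hπ : Measurable π) (hh : Measurable h) (j : Fin d) : Measurable (weightedSq π h j) := by
  have h1 : Measurable fun z : FullData p => h (covX z) j :=
    (measurable_pi_apply j).comp (hh.comp measurable_covX)
  have h2 : Measurable fun z : FullData p => π (covX z) := hπ.comp measurable_covX
  exact measurable_indT.mul ((h1.pow_const 2).div (h2.pow_const 2))

theorem orliczNorm_coord_le {m : (Fin p → ℝ) → ℝ} {h : (Fin p → ℝ) → Fin d → ℝ} {σε σh : ℝ}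
    (hs : SubGaussianAssumptions ν m h σε σh) (j : Fin d) :
    orliczNorm 2 (fun z => h (covX z) j) ν ≤ ENNReal.ofReal σh :=
  (le_iSup (fun j => orliczNorm 2 (fun z => h (covX z) j) ν) j).trans hs.h_subGaussian

theorem positivity_ae {π : (Fin p → ℝ) → ℝ} {δ : ℝ} (hb : BasicAssumptions ν π δ) :
    ∀ᵐ z ∂ν, δ ≤ π (covX z) :=
  ae_of_ae_map measurable_covX.aemeasurable hb.positivity

/-- By positivity `T h_j²/π² ≤ h_j²/δ²`, so a scale `K` for the square corresponds to the scale `δ√K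
> σ_h` for `h_j` itself. -/
theorem integral_exp_weightedSq_le {π m : (Fin p → ℝ) → ℝ}
    {h : (Fin p → ℝ) → Fin d → ℝ} {δ σε σh : ℝ} (hπ : Measurable π) (hh : Measurable h)
    (hb : BasicAssumptions ν π δ) (hs : SubGaussianAssumptions ν m h σε σh) (j : Fin d)
    {K : ℝ} (hK : σh ^ 2 / δ ^ 2 < K) :
    Integrable (fun z => Real.exp (weightedSq π h j z / K)) ν ∧
      ∫ z, Real.exp (weightedSq π h j z / K) ∂ν ≤ 2 := by
  have hδ := hb.delta_pos
  have hK0 : 0 < K := lt_of_le_of_lt (by positivity) hK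
  set c := δ * √K with hc
  have hc0 : 0 < c := mul_pos hδ (Real.sqrt_pos.2 hK0)
  have hc2 : c ^ 2 = δ ^ 2 * K := by rw [hc, mul_pow, Real.sq_sqrt hK0.le]
  have hσc : σh < c := by
    refine lt_of_pow_lt_pow_left₀ 2 hc0.le ?_
    rw [hc2, mul_comm]
    exact (div_lt_iff₀ (by positivity)).1 hK
  have hm1 : Measurable fun z : FullData p => h (covX z) j :=
    (measurable_pi_apply j).comp (hh.comp measurable_covX)
  obtain ⟨h1, h2⟩ := integral_exp_sq_le_two hm1.aemeasurable (orliczNorm_coord_le hs j) hc0 hσc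
  have hle : ∀ᵐ z ∂ν, Real.exp (weightedSq π h j z / K) ≤
      Real.exp ((h (covX z) j / c) ^ 2) := by
    filter_upwards [positivity_ae hb] with z hz
    refine Real.exp_le_exp.2 ?_
    rw [div_pow, hc2, ← div_div]
    refine div_le_div_of_nonneg_right ?_ hK0.le
    unfold weightedSq
    calc indT z * (h (covX z) j ^ 2 / π (covX z) ^ 2)
        ≤ 1 * (h (covX z) j ^ 2 / π (covX z) ^ 2) := by
          gcongr; exact indT_le_one z
      _ ≤ h (covX z) j ^ 2 / δ ^ 2 := by rw [one_mul]; gcongr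
  have hint : Integrable (fun z => Real.exp (weightedSq π h j z / K)) ν := by
    refine h1.mono' ((measurable_weightedSq hπ hh j).div_const K).exp.aestronglyMeasurable ?_
    filter_upwards [hle] with z hz
    rwa [Real.norm_of_nonneg (Real.exp_pos _).le]
  exact ⟨hint, (integral_mono_ae hint h1 hle).trans h2⟩

theorem norm_secondMoment_le {m : (Fin p → ℝ) → ℝ} {h : (Fin p → ℝ) → Fin d → ℝ} {σε σh : ℝ}
    (hh : Measurable h) (hs : SubGaussianAssumptions ν m h σε σh) :
    ‖secondMoment ν h‖ ≤ σh ^ 2 := by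
  refine (pi_norm_le_iff_of_nonneg (sq_nonneg _)).2 fun j => ?_
  have hm1 : Measurable fun z : FullData p => h (covX z) j :=
    (measurable_pi_apply j).comp (hh.comp measurable_covX)
  unfold secondMoment
  rw [Real.norm_of_nonneg (integral_nonneg fun z => sq_nonneg _)]
  exact (integral_sq_le_of_orliczNorm_le hs.sigma_h_nonneg hm1.aemeasurable
    (orliczNorm_coord_le hs j)).2

/-- Conditioning on `X` replaces `T` by `π(X)` and cancels one of the two factors `1/π`, hence `1/δ`
and not `1/δ²`. -/
theorem integral_weightedSq_le {π m : (Fin p → ℝ) → ℝ}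
    {h : (Fin p → ℝ) → Fin d → ℝ} {δ σε σh : ℝ} (hπ : IsPropensityScore ν π)
    (hh : Measurable h) (hb : BasicAssumptions ν π δ) (hs : SubGaussianAssumptions ν m h σε σh)
    (j : Fin d) : ∫ z, weightedSq π h j z ∂ν ≤ ‖secondMoment ν h‖ / δ := by
  have hδ := hb.delta_pos
  have hm1 : Measurable fun z : FullData p => h (covX z) j :=
    (measurable_pi_apply j).comp (hh.comp measurable_covX)
  have hI := (integral_sq_le_of_orliczNorm_le hs.sigma_h_nonneg hm1.aemeasurable
    (orliczNorm_coord_le hs j)).1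
  set g : FullData p → ℝ := fun z => h (covX z) j ^ 2 / π (covX z) ^ 2 with hg
  have hgm : StronglyMeasurable[sigmaX p] g := by
    have : Measurable fun x : Fin p → ℝ => h x j ^ 2 / π x ^ 2 :=
      (((measurable_pi_apply j).comp hh).pow_const 2).div (hπ.1.pow_const 2)
    exact this.stronglyMeasurable.comp_measurable (comap_measurable covX)
  have hgle : ∀ᵐ z ∂ν, g z ≤ h (covX z) j ^ 2 / δ ^ 2 := by
    filter_upwards [positivity_ae hb] with z hz
    simp only [hg]
    gcongr
  have hgint : Integrable g ν := by
    refine (hI.div_const (δ ^ 2)).mono' (hgm.mono (sigmaX_le p)).aestronglyMeasurable ?_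
    filter_upwards [hgle] with z hz
    rwa [Real.norm_of_nonneg (by positivity)]
  have hTint : Integrable (indT : FullData p → ℝ) ν :=
    (integrable_const (1 : ℝ)).mono' measurable_indT.aestronglyMeasurable (ae_of_all _ fun z => by
      rw [Real.norm_of_nonneg (indT_nonneg z)]; exact indT_le_one z)
  have hTg : Integrable (indT * g) ν := by
    refine hgint.mono' (measurable_indT.aestronglyMeasurable.mul hgint.1) (ae_of_all _ fun z => ?_)
    have hgz : 0 ≤ g z := by positivity
    rw [Pi.mul_apply, Real.norm_of_nonneg (mul_nonneg (indT_nonneg z) hgz)]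
    exact mul_le_of_le_one_left hgz (indT_le_one z)
  have hpull := condExp_mul_of_stronglyMeasurable_right hgm hTg hTint
  have hstep : ∫ z, weightedSq π h j z ∂ν = ∫ z, π (covX z) * g z ∂ν := by
    calc ∫ z, weightedSq π h j z ∂ν = ∫ z, (ν[indT * g | sigmaX p]) z ∂ν :=
          (integral_condExp (sigmaX_le p)).symm
      _ = _ := by
          refine integral_congr_ae ?_
          filter_upwards [hpull, hπ.2] with z h1 h2
          rw [h1, Pi.mul_apply, ← h2]
  rw [hstep]
  calc ∫ z, π (covX z) * g z ∂ν ≤ ∫ z, h (covX z) j ^ 2 / δ ∂ν := by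
        refine integral_mono_of_nonneg ?_ (hI.div_const δ) ?_
        · filter_upwards [positivity_ae hb] with z hz
          have : 0 ≤ π (covX z) := hδ.le.trans hz
          simp only [Pi.zero_apply]
          positivity
        · filter_upwards [positivity_ae hb] with z hz
          have hpos : 0 < π (covX z) := hδ.trans_le hz
          calc π (covX z) * g z = h (covX z) j ^ 2 / π (covX z) := by
                simp only [hg]; field_simp
            _ ≤ _ := by gcongr
    _ = secondMoment ν h j / δ := integral_div _ _
    _ ≤ _ := by
        gcongr
        exact (le_abs_self _).trans (norm_le_pi_norm (secondMoment ν h) j)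

end Population

/-- A union bound over `x` events at level `c √log x`; the factor `x` costs the `-1` in the
exponent. -/
theorem mul_exp_neg_sq_eq_rpow {x : ℝ} (hx : 1 ≤ x) (c : ℝ) :
    x * Real.exp (-(c * √(Real.log x)) ^ 2) = x ^ (-(c ^ 2 - 1)) := by
  have hx0 : 0 < x := by linarith
  rw [mul_pow, Real.sq_sqrt (Real.log_nonneg hx), Real.rpow_def_of_pos hx0]
  nth_rewrite 1 [← Real.exp_log hx0]
  rw [← Real.exp_add]
  congr 1
  ring

/-! ### The error weights in `T_{π,n}` -/

section Weights

variable {n p d : ℕ}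

/-- The weight of the `i`-th error in the `j`-th coordinate of `T_{π,n}`. -/
noncomputable def errWeight (A : Procedure n p) (π : (Fin p → ℝ) → ℝ)
    (h : (Fin p → ℝ) → Fin d → ℝ) (j : Fin d) (i : Fin n) (D : Fin n → Bool × (Fin p → ℝ)) : ℝ :=
  1 / (n : ℝ) * (((if (D i).1 then 1 else 0) / A D (D i).2 -
    (if (D i).1 then 1 else 0) / π (D i).2) * h (D i).2 j)

/-- `T h_j(X)² / π(X)²` as a function of `(T, X)`. -/
noncomputable def weightedSqPair (π : (Fin p → ℝ) → ℝ) (h : (Fin p → ℝ) → Fin d → ℝ) (j : Fin d)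
    (w : Bool × (Fin p → ℝ)) : ℝ :=
  (if w.1 then 1 else 0) * ((h w.2 j) ^ 2 / π w.2 ^ 2)

theorem measurable_ind : Measurable fun w : Bool × (Fin p → ℝ) => if w.1 then (1 : ℝ) else 0 :=
  Measurable.ite (measurable_fst (measurableSet_singleton true)) measurable_const
    measurable_const

theorem measurable_errWeight {A : Procedure n p} {π : (Fin p → ℝ) → ℝ}
    {h : (Fin p → ℝ) → Fin d → ℝ}
    (hA : ∀ i, Measurable fun D : Fin n → Bool × (Fin p → ℝ) => A D (D i).2)
    (hπ : Measurable π) (hh : Measurable h) (j : Fin d) (i : Fin n) :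
    Measurable (errWeight A π h j i) := by
  have hD : Measurable fun D : Fin n → Bool × (Fin p → ℝ) => D i := measurable_pi_apply i
  have h1 : Measurable fun D : Fin n → Bool × (Fin p → ℝ) => if (D i).1 then (1 : ℝ) else 0 :=
    measurable_ind.comp hD
  have h2 : Measurable fun D : Fin n → Bool × (Fin p → ℝ) => π (D i).2 :=
    hπ.comp (measurable_snd.comp hD)
  have h3 : Measurable fun D : Fin n → Bool × (Fin p → ℝ) => h (D i).2 j :=
    (measurable_pi_apply j).comp (hh.comp (measurable_snd.comp hD))
  exact (((h1.div (hA i)).sub (h1.div h2)).mul h3).const_mul _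

theorem measurable_weightedSqPair {π : (Fin p → ℝ) → ℝ} {h : (Fin p → ℝ) → Fin d → ℝ}
    (hπ : Measurable π) (hh : Measurable h) (j : Fin d) : Measurable (weightedSqPair π h j) :=
  measurable_ind.mul ((((measurable_pi_apply j).comp (hh.comp measurable_snd)).pow_const 2).div
    ((hπ.comp measurable_snd).pow_const 2))

theorem tPiAvg_apply {Ω : Type*} [MeasurableSpace Ω] (A : Procedure n p)
    (Z : Fin n → Ω → FullData p) (π m : (Fin p → ℝ) → ℝ) (h : (Fin p → ℝ) → Fin d → ℝ) (ω : Ω)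
    (j : Fin d) :
    tPiAvg A Z π m h ω j =
      ∑ i, errWeight A π h j i (obsPairs fun i => Z i ω) * err m (Z i ω) := by
  simp only [tPiAvg, tPi, Pi.smul_apply, Finset.sum_apply, smul_eq_mul, Finset.mul_sum]
  refine Finset.sum_congr rfl fun i _ => ?_
  have hA : piHat A Z ω = A (obsPairs fun i => Z i ω) := rfl
  have hX : (obsPairs (fun i => Z i ω) i).2 = covX (Z i ω) := rfl
  have hT : (if (obsPairs (fun i => Z i ω) i).1 then (1 : ℝ) else 0) = indT (Z i ω) := rfl
  simp only [errWeight, err, hA, hX, hT]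
  ring

/-- The estimate of the squared weights when the fitted propensity scores are accurate. -/
theorem errWeight_sq_le {A : Procedure n p} {π : (Fin p → ℝ) → ℝ}
    {h : (Fin p → ℝ) → Fin d → ℝ} {δ r : ℝ} (hδ : 0 < δ) {D : Fin n → Bool × (Fin p → ℝ)}
    (j : Fin d) (i : Fin n) (h1 : |A D (D i).2 - π (D i).2| ≤ r)
    (h2 : |A D (D i).2 - π (D i).2| ≤ δ / 2) (h3 : δ ≤ π (D i).2) :
    errWeight A π h j i D ^ 2 ≤ (1 / (n : ℝ)) ^ 2 * (2 * r / δ) ^ 2 *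
      weightedSqPair π h j (D i) := by
  have hr : 0 ≤ r := (abs_nonneg _).trans h1
  unfold errWeight weightedSqPair
  set a := A D (D i).2
  set b := π (D i).2
  have hb : 0 < b := hδ.trans_le h3
  -- The bound `δ/2` only keeps the denominator `π̂` away from zero; the rate comes from `r`.
  have ha : δ / 2 ≤ a := by linarith [(abs_le.1 h2).1]
  have ha0 : 0 < a := by linarith
  by_cases ht : (D i).1
  · simp only [ht, if_true]
    have h4 : (1 / a - 1 / b) ^ 2 ≤ (2 * r / δ) ^ 2 * (1 / b ^ 2) := by
      -- The factor `1/b²` is kept unestimated, since it is part of `weightedSqPair`.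
      have h5 : (1 / a - 1 / b) ^ 2 = (a - b) ^ 2 / a ^ 2 * (1 / b ^ 2) := by field_simp; ring
      rw [h5, ← div_pow]
      refine mul_le_mul_of_nonneg_right ?_ (by positivity)
      rw [← sq_abs]
      refine pow_le_pow_left₀ (abs_nonneg _) ?_ 2
      rw [abs_div, abs_of_pos ha0]
      calc |a - b| / a ≤ r / (δ / 2) := by gcongr
        _ = _ := by field_simp
    calc (1 / (n : ℝ) * ((1 / a - 1 / b) * h (D i).2 j)) ^ 2
        = (1 / (n : ℝ)) ^ 2 * ((1 / a - 1 / b) ^ 2 * h (D i).2 j ^ 2) := by ring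
      _ ≤ (1 / (n : ℝ)) ^ 2 * ((2 * r / δ) ^ 2 * (1 / b ^ 2) * h (D i).2 j ^ 2) := by gcongr
      _ = _ := by ring
  · simp [ht]

end Weights

/-! ### The non-asymptotic bound -/

section Model

variable {Ω : Type*} [MeasurableSpace Ω] {P : Measure Ω} {n p d : ℕ}
  {Z : Fin n → Ω → FullData p} {ν : Measure (FullData p)}
  {A : Procedure n p} {π m : (Fin p → ℝ) → ℝ} {h : (Fin p → ℝ) → Fin d → ℝ}
  {v q C δ σε σh : ℝ}

theorem IsIIDSample.map_eq_pi [IsProbabilityMeasure P] (hZ : IsIIDSample P Z ν) :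
    P.map (fun ω i => Z i ω) = Measure.pi fun _ => ν := by
  rw [(iIndepFun_iff_map_fun_eq_pi_map fun i => (hZ.measurable i).aemeasurable).1 hZ.indep]
  simp only [hZ.law]

theorem IsIIDSample.measureReal_preimage_le [IsProbabilityMeasure P] (hZ : IsIIDSample P Z ν)
    {s : Set (Fin n → FullData p)} {x : ℝ} (hx : 0 ≤ x)
    (hs : (Measure.pi fun _ => ν) s ≤ ENNReal.ofReal x) :
    P.real ((fun ω i => Z i ω) ⁻¹' s) ≤ x := by
  refine ENNReal.toReal_le_of_le_ofReal hx (le_trans ?_ hs)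
  rw [← hZ.map_eq_pi]
  exact Measure.le_map_apply (measurable_pi_lambda _ hZ.measurable).aemeasurable s

/-- A union bound over the `n` training points only; `n` is enlarged to `n * d` to match the
logarithm in the level. -/
theorem TailAssumptions.measureReal_exists_le (ht : TailAssumptions P Z A π v q C)
    (hd : 1 ≤ d) (hn : 1 ≤ n) {c : ℝ} (hc : 0 ≤ c) :
    P.real {ω | ∃ i, c * √(Real.log (n * d)) * v <
        |piHat A Z ω (covX (Z i ω)) - π (covX (Z i ω))|} ≤
      C * ((n : ℝ) * d) ^ (-(c ^ 2 - 1)) + q * (n * d) := by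
  have hn' : (1 : ℝ) ≤ n := by exact_mod_cast hn
  have hd' : (1 : ℝ) ≤ d := by exact_mod_cast hd
  have hnd : (1 : ℝ) ≤ n * d := by nlinarith
  have hnle : (n : ℝ) ≤ n * d := by nlinarith
  set t := c * √(Real.log (n * d)) with htdef
  have hset : {ω | ∃ i, t * v < |piHat A Z ω (covX (Z i ω)) - π (covX (Z i ω))|} =
      ⋃ i, {ω | t * v < |piHat A Z ω (covX (Z i ω)) - π (covX (Z i ω))|} := by
    ext ω; simp
  have hnn : 0 ≤ C * Real.exp (-t ^ 2) + q :=
    add_nonneg (mul_nonneg ht.C_nonneg (Real.exp_pos _).le) ht.q_nonneg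
  rw [hset]
  calc _ ≤ ∑ i : Fin n, P.real {ω | t * v < |piHat A Z ω (covX (Z i ω)) - π (covX (Z i ω))|} :=
        measureReal_iUnion_fintype_le _
    _ ≤ ∑ _i : Fin n, (C * Real.exp (-t ^ 2) + q) :=
        Finset.sum_le_sum fun i _ => ht.tail t (by positivity) i
    _ = n * (C * Real.exp (-t ^ 2) + q) := by simp [mul_add]
    _ ≤ (n * d) * (C * Real.exp (-t ^ 2) + q) := by gcongr
    _ = C * (n * d * Real.exp (-t ^ 2)) + q * (n * d) := by ring
    _ = _ := by rw [htdef, mul_exp_neg_sq_eq_rpow hnd]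

theorem ModelAssumptions.measureReal_lt_sum_weightedSq_le [IsProbabilityMeasure P] [IsProbabilityMeasure ν]

    (H : ModelAssumptions P Z ν A π m h v q C δ σε σh) {c₃ : ℝ} (hc₃ : 1 < c₃)
    (hlt : c₃ * √(Real.log d / n) < 1) (j : Fin d) :
    P.real {ω | n * (‖secondMoment ν h‖ / δ + const2 c₃ σh δ * √(Real.log d / n)) <
      ∑ i, weightedSq π h j (Z i ω)} ≤ Real.exp (-(c₃ * √(Real.log d)) ^ 2) := by
  have hn0 : (0 : ℝ) < n := by exact_mod_cast H.one_le_n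
  have hd1 : (1 : ℝ) < d := by exact_mod_cast H.two_le_d
  have hlog := Real.log_pos hd1
  have hr : 0 < √(Real.log d / n) := Real.sqrt_pos.2 (by positivity)
  have hB := pi_measure_lt_sum_le_exp H.one_le_n
    (measurable_weightedSq H.propensity.1 H.measurable_h j)
    (ae_of_all ν (weightedSq_nonneg π h j)) (K₀ := σh ^ 2 / δ ^ 2)
    (e := c₃ * √(Real.log d / n)) (by positivity)
    (fun K hK => integral_exp_weightedSq_le H.propensity.1 H.measurable_h H.basic H.subGaussian
      j hK) (by positivity) hlt.le
  have h1 := H.sample.measureReal_preimage_le (Real.exp_pos _).le hB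
  have h2 : -((n : ℝ) * (c₃ * √(Real.log d / n)) ^ 2) = -(c₃ * √(Real.log d)) ^ 2 := by
    rw [mul_pow, mul_pow, Real.sq_sqrt (by positivity), Real.sq_sqrt hlog.le]
    field_simp
  rw [h2] at h1
  refine le_trans (measureReal_mono fun ω hω => ?_) h1
  have hω' : n * (‖secondMoment ν h‖ / δ + const2 c₃ σh δ * √(Real.log d / n)) <
      ∑ i, weightedSq π h j (Z i ω) := hω
  have h3 := integral_weightedSq_le H.propensity H.measurable_h H.basic H.subGaussian j
  -- `√2 · 2√2 + 2 = 6`, the constant of the Bernstein bound.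
  have h4 : const2 c₃ σh δ * √(Real.log d / n) =
      6 * (σh ^ 2 / δ ^ 2) * (c₃ * √(Real.log d / n)) := by
    have h5 : √2 * (2 * √2 * σh ^ 2 / δ ^ 2) = 4 * (σh ^ 2 / δ ^ 2) := by
      have : √2 * √(2 : ℝ) = 2 := Real.mul_self_sqrt (by norm_num)
      linear_combination (2 * σh ^ 2 / δ ^ 2) * this
    unfold const2
    rw [h5]
    ring
  refine lt_of_le_of_lt ?_ hω'
  rw [h4]
  gcongr

/-- The rate in the non-asymptotic bound, in the form in which the Chernoff bound yields it. -/
theorem mul_sqrt_eight_mul_eq {l N c c₁ w B : ℝ} (hl : 0 ≤ l) (hN : 0 < N) (hσ : 0 ≤ σε)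
    (hδ : 0 < δ) (hc₁ : 0 ≤ c₁) (hw : 0 ≤ w) (hB : 0 ≤ B) :
    c * √l * √(8 * (σε ^ 2 * (1 / N * (2 * (c₁ * w) / δ) ^ 2 * B))) =
      c * √(l / N) * w * const1 c₁ σε δ * √B := by
  have h1 : 8 * (σε ^ 2 * (1 / N * (2 * (c₁ * w) / δ) ^ 2 * B)) =
      (const1 c₁ σε δ * w * √B * √(1 / N)) ^ 2 := by
    unfold const1
    simp only [mul_pow, div_pow]
    have hN' : 0 ≤ 1 / N := by positivity
    have h2 : √(2 : ℝ) ^ 2 = 2 := Real.sq_sqrt (by norm_num)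
    rw [Real.sq_sqrt hB, Real.sq_sqrt hN', h2]
    ring
  have h2 : 0 ≤ const1 c₁ σε δ := by unfold const1; positivity
  rw [h1, Real.sqrt_sq (by positivity), div_eq_mul_one_div l N, Real.sqrt_mul hl]
  ring

/-- The non-asymptotic bound on `‖T_{π,n}‖`. -/
theorem ModelAssumptions.le_measureReal_norm_tPiAvg_le [IsProbabilityMeasure P] [IsProbabilityMeasure ν]

    (H : ModelAssumptions P Z ν A π m h v q C δ σε σh) {c c₁ c₂ c₃ : ℝ} (hc : 1 < c)
    (hc₁ : 1 < c₁) (hc₂ : 1 < c₂) (hc₃ : 1 < c₃)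
    (hv : c₂ * (v * √(Real.log (n * d))) ≤ δ / 2) (hlt : c₃ * √(Real.log d / n) < 1) :
    1 - 2 * (d : ℝ) ^ (-(c ^ 2 - 1)) - 4 * (d : ℝ) ^ (-(c₃ ^ 2 - 1))
        - 2 * C * ((n : ℝ) * d) ^ (-(c₁ ^ 2 - 1)) - 2 * C * ((n : ℝ) * d) ^ (-(c₂ ^ 2 - 1))
        - 4 * q * (n * d) ≤
      P.real {ω | ‖tPiAvg A Z π m h ω‖ ≤
        c * √(Real.log d / n) * (v * √(Real.log (n * d))) * const1 c₁ σε δ *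
          √(‖secondMoment ν h‖ / δ + const2 c₃ σh δ * √(Real.log d / n))} := by
  have hn0 : (0 : ℝ) < n := by exact_mod_cast H.one_le_n
  have hd1 : (1 : ℝ) < d := by exact_mod_cast H.two_le_d
  have hδ := H.basic.delta_pos
  have hσε := H.subGaussian.sigma_err_nonneg
  have hvnn := H.tail.v_nonneg
  have hlog := Real.log_pos hd1
  have hd1' : 1 ≤ d := by have := H.two_le_d; omega
  set w := v * √(Real.log (n * d)) with hw
  have hw0 : 0 ≤ w := by positivity
  set B := ‖secondMoment ν h‖ / δ + const2 c₃ σh δ * √(Real.log d / n) with hB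
  have hB0 : 0 ≤ B := by
    have : 0 ≤ const2 c₃ σh δ := by unfold const2; positivity
    positivity
  set V := 1 / (n : ℝ) * (2 * (c₁ * w) / δ) ^ 2 * B with hVdef
  have hV0 : 0 ≤ V := by positivity
  set u := c * √(Real.log d / n) * w * const1 c₁ σε δ * √B with hu
  have hueq : c * √(Real.log d) * √(8 * (σε ^ 2 * V)) = u :=
    mul_sqrt_eight_mul_eq hlog.le hn0 hσε hδ (by linarith) hw0 hB0
  have hu0 : 0 ≤ u := by rw [← hueq]; positivity
  -- All conditions behind `∑ b_i² ≤ V`, phrased through the pairs alone so that the errors are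
  -- still sub-Gaussian on `G j`.
  let G : Fin d → Set (Fin n → Bool × (Fin p → ℝ)) := fun j =>
    (⋂ i, ({D | |A D (D i).2 - π (D i).2| ≤ c₁ * w} ∩
      ({D | |A D (D i).2 - π (D i).2| ≤ δ / 2} ∩ {D | δ ≤ π (D i).2}))) ∩
    {D | ∑ i, weightedSqPair π h j (D i) ≤ n * B}
  have hGm : ∀ j, MeasurableSet (G j) := by
    intro j
    have hD : ∀ i, Measurable fun D : Fin n → Bool × (Fin p → ℝ) => D i := fun i =>
      measurable_pi_apply i
    have h2 : ∀ i, Measurable fun D : Fin n → Bool × (Fin p → ℝ) => π (D i).2 := fun i =>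
      H.propensity.1.comp (measurable_snd.comp (hD i))
    have h3 : ∀ i, Measurable fun D : Fin n → Bool × (Fin p → ℝ) =>
        |A D (D i).2 - π (D i).2| := fun i => ((H.tail.measurable_fit i).sub (h2 i)).abs
    refine MeasurableSet.inter (MeasurableSet.iInter fun i => ?_) ?_
    · exact (measurableSet_le (h3 i) measurable_const).inter
        ((measurableSet_le (h3 i) measurable_const).inter
          (measurableSet_le measurable_const (h2 i)))
    · exact measurableSet_le (Finset.measurable_sum _ fun i _ =>
        (measurable_weightedSqPair H.propensity.1 H.measurable_h j).comp (hD i)) measurable_const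
  have hGV : ∀ j, ∀ D ∈ G j, ∑ i, errWeight A π h j i D ^ 2 ≤ V := by
    rintro j D ⟨hD1, hD2⟩
    rw [Set.mem_iInter] at hD1
    have hD2' : ∑ i, weightedSqPair π h j (D i) ≤ n * B := hD2
    calc ∑ i, errWeight A π h j i D ^ 2
        ≤ ∑ i, (1 / (n : ℝ)) ^ 2 * (2 * (c₁ * w) / δ) ^ 2 * weightedSqPair π h j (D i) :=
          Finset.sum_le_sum fun i _ =>
            errWeight_sq_le hδ j i (hD1 i).1 (hD1 i).2.1 (hD1 i).2.2
      _ = (1 / (n : ℝ)) ^ 2 * (2 * (c₁ * w) / δ) ^ 2 * ∑ i, weightedSqPair π h j (D i) :=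
          (Finset.mul_sum _ _ _).symm
      _ ≤ (1 / (n : ℝ)) ^ 2 * (2 * (c₁ * w) / δ) ^ 2 * (n * B) := by gcongr
      _ = V := by rw [hVdef]; field_simp
  let bad₁ : Set Ω := {ω | ∃ i, c₁ * √(Real.log (n * d)) * v <
    |piHat A Z ω (covX (Z i ω)) - π (covX (Z i ω))|}
  let bad₂ : Set Ω := {ω | ∃ i, c₂ * √(Real.log (n * d)) * v <
    |piHat A Z ω (covX (Z i ω)) - π (covX (Z i ω))|}
  let bad₃ : Set Ω := {ω | ¬ ∀ i, δ ≤ π (covX (Z i ω))}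
  let bad₄ : Fin d → Set Ω := fun j => {ω | n * B < ∑ i, weightedSq π h j (Z i ω)}
  let bad₅ : Fin d → Set Ω := fun j => (fun ω i => Z i ω) ⁻¹' (obsPairs ⁻¹' (G j) ∩
    {z | c * √(Real.log d) * √(8 * (σε ^ 2 * V)) <
      |∑ i, errWeight A π h j i (obsPairs z) * err m (z i)|})
  have hbad₁ : P.real bad₁ ≤ _ := H.tail.measureReal_exists_le hd1' H.one_le_n (c := c₁)
    (by linarith)
  have hbad₂ : P.real bad₂ ≤ _ := H.tail.measureReal_exists_le hd1' H.one_le_n (c := c₂)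
    (by linarith)
  have hbad₃ : P.real bad₃ = 0 := by
    have h1 : ∀ᵐ ω ∂P, ∀ i, δ ≤ π (covX (Z i ω)) := by
      refine ae_all_iff.2 fun i => ?_
      have h2 := positivity_ae H.basic
      rw [← H.sample.law i] at h2
      exact ae_of_ae_map (H.sample.measurable i).aemeasurable h2
    rw [measureReal_def, ae_iff.1 h1, ENNReal.toReal_zero]
  have hbad₄ : P.real (⋃ j, bad₄ j) ≤ (d : ℝ) ^ (-(c₃ ^ 2 - 1)) := by
    rw [← mul_exp_neg_sq_eq_rpow hd1.le]
    calc _ ≤ ∑ j, P.real (bad₄ j) := measureReal_iUnion_fintype_le _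
      _ ≤ ∑ _j : Fin d, Real.exp (-(c₃ * √(Real.log d)) ^ 2) :=
          Finset.sum_le_sum fun j _ => H.measureReal_lt_sum_weightedSq_le hc₃ hlt j
      _ = _ := by simp
  have hbad₅ : P.real (⋃ j, bad₅ j) ≤ 2 * (d : ℝ) ^ (-(c ^ 2 - 1)) := by
    rw [← mul_exp_neg_sq_eq_rpow hd1.le]
    calc _ ≤ ∑ j, P.real (bad₅ j) := measureReal_iUnion_fintype_le _
      _ ≤ ∑ _j : Fin d, 2 * Real.exp (-(c * √(Real.log d)) ^ 2) :=
          Finset.sum_le_sum fun j _ => H.sample.measureReal_preimage_le (by positivity)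
            (pi_measure_sqrt_lt_abs_sum_err_le H.basic H.regression H.subGaussian
              (measurable_errWeight H.tail.measurable_fit H.propensity.1 H.measurable_h j)
              (hGm j) hV0 (by positivity) (hGV j))
      _ = _ := by simp; ring
  -- Outside the first four bad events the pairs lie in every `G j`, so a large coordinate forces
  -- membership in `bad₅`.
  have hcover : (Set.univ : Set Ω) ⊆ {ω | ‖tPiAvg A Z π m h ω‖ ≤ u} ∪
      (bad₁ ∪ (bad₂ ∪ (bad₃ ∪ ((⋃ j, bad₄ j) ∪ ⋃ j, bad₅ j)))) := by
    intro ω _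
    by_contra hω
    simp only [Set.mem_union, Set.mem_iUnion, not_or, not_exists] at hω
    obtain ⟨h0, h1, h2, h3, h4, h5⟩ := hω
    refine h0 ((pi_norm_le_iff_of_nonneg hu0).2 fun j => ?_)
    by_contra hj
    rw [not_le, Real.norm_eq_abs, tPiAvg_apply, ← hueq] at hj
    have h1' : ∀ i, |piHat A Z ω (covX (Z i ω)) - π (covX (Z i ω))| ≤
        c₁ * √(Real.log (n * d)) * v := fun i => not_lt.1 fun hi => h1 ⟨i, hi⟩
    have h2' : ∀ i, |piHat A Z ω (covX (Z i ω)) - π (covX (Z i ω))| ≤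
        c₂ * √(Real.log (n * d)) * v := fun i => not_lt.1 fun hi => h2 ⟨i, hi⟩
    have h3' : ∀ i, δ ≤ π (covX (Z i ω)) := not_not.1 h3
    have h4' : ∑ i, weightedSq π h j (Z i ω) ≤ n * B := not_lt.1 (h4 j)
    refine h5 j ⟨⟨Set.mem_iInter.2 fun i => ⟨?_, ?_, h3' i⟩, h4'⟩, hj⟩
    · exact (h1' i).trans (le_of_eq (by rw [hw]; ring))
    · exact ((h2' i).trans (le_of_eq (by rw [hw]; ring))).trans hv
  have h1 : (1 : ℝ) ≤ P.real {ω | ‖tPiAvg A Z π m h ω‖ ≤ u} + (P.real bad₁ + (P.real bad₂ +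
      (P.real bad₃ + (P.real (⋃ j, bad₄ j) + P.real (⋃ j, bad₅ j))))) := by
    calc (1 : ℝ) = P.real Set.univ := by simp
      _ ≤ _ := measureReal_mono hcover
      _ ≤ _ := (measureReal_union_le _ _).trans (by
        gcongr
        refine (measureReal_union_le _ _).trans ?_
        gcongr
        refine (measureReal_union_le _ _).trans ?_
        gcongr
        refine (measureReal_union_le _ _).trans ?_
        gcongr
        exact measureReal_union_le _ _)
  -- The union bound gives coefficients `1`, `C`, `C`, `2` where the statement allows `4`, `2C`,
  -- `2C`, `4`; nonnegativity covers the difference.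
  have hq := mul_nonneg H.tail.q_nonneg (by positivity : (0 : ℝ) ≤ n * d)
  have e1 := mul_nonneg H.tail.C_nonneg
    (by positivity : 0 ≤ ((n : ℝ) * d) ^ (-(c₁ ^ 2 - 1)))
  have e2 := mul_nonneg H.tail.C_nonneg
    (by positivity : 0 ≤ ((n : ℝ) * d) ^ (-(c₂ ^ 2 - 1)))
  have e3 : 0 ≤ (d : ℝ) ^ (-(c₃ ^ 2 - 1)) := by positivity
  linarith

end Model

/-! ### Choice of constants along a sequence of models -/

theorem exists_forall_rpow_neg_le {η : ℝ} (hη : 0 < η) :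
    ∃ K : ℝ, 1 < K ∧ ∀ x : ℝ, 2 ≤ x → x ^ (-(K ^ 2 - 1)) ≤ η := by
  obtain ⟨k, hk⟩ := exists_pow_lt_of_lt_one hη (by norm_num : (1 / 2 : ℝ) < 1)
  have hk0 : (0 : ℝ) ≤ k := Nat.cast_nonneg k
  refine ⟨k + 2, by linarith, fun x hx => le_trans ?_ hk.le⟩
  calc x ^ (-(((k : ℝ) + 2) ^ 2 - 1)) ≤ x ^ (-(k : ℝ)) :=
        Real.rpow_le_rpow_of_exponent_le (by linarith) (by nlinarith)
    _ ≤ 2 ^ (-(k : ℝ)) := Real.rpow_le_rpow_of_nonpos (by norm_num) hx (by linarith)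
    _ = (1 / 2 : ℝ) ^ k := by
        rw [Real.rpow_neg (by norm_num), Real.rpow_natCast, one_div, inv_pow]

theorem exists_forall_ge_rpow_neg_le {c η : ℝ} (hc : 1 < c) (hη : 0 < η) :
    ∃ D : ℝ, 1 ≤ D ∧ ∀ x : ℝ, D ≤ x → x ^ (-(c ^ 2 - 1)) ≤ η := by
  have h1 : Tendsto (fun x : ℝ => x ^ (-(c ^ 2 - 1))) atTop (𝓝 0) :=
    tendsto_rpow_neg_atTop (by nlinarith)
  obtain ⟨D, hD⟩ := eventually_atTop.1 (h1.eventually_le_const hη)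
  exact ⟨max D 1, le_max_right _ _, fun x hx => hD x ((le_max_left _ _).trans hx)⟩

/-- A threshold for Bernstein's inequality, bounded along the sequence, whose exceptional
probability is uniformly small. -/
theorem exists_bernstein_threshold {d : ℕ → ℕ} (hd : ∀ n, 1 ≤ n → 2 ≤ d n) {c : ℝ} (hc : 1 < c)
    (hlt : ∀ᶠ n : ℕ in atTop, c * √(Real.log (d n) / n) < 1) {η : ℝ} (hη : 0 < η) :
    ∃ K : ℝ, ∀ᶠ n : ℕ in atTop, ∃ c' : ℝ, 1 < c' ∧ c' ≤ K ∧
      c' * √(Real.log (d n) / n) < 1 ∧ (d n : ℝ) ^ (-(c' ^ 2 - 1)) ≤ η := by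
  obtain ⟨K, hK1, hK⟩ := exists_forall_rpow_neg_le hη
  obtain ⟨D, hD1, hD⟩ := exists_forall_ge_rpow_neg_le hc hη
  refine ⟨max c K, ?_⟩
  have h1 : Tendsto (fun n : ℕ => K * √(Real.log D / n)) atTop (𝓝 0) := by
    have h2 : Tendsto (fun n : ℕ => Real.log D / n) atTop (𝓝 0) :=
      tendsto_const_div_atTop_nhds_zero_nat _
    simpa using (h2.sqrt).const_mul K
  filter_upwards [hlt, h1.eventually_lt_const one_pos, eventually_ge_atTop 1] with n hn hn' hn1
  -- If `d n ≥ D`, the given `c` already makes the power small. Otherwise `log (d n) / n ≤ log D / n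
  -- → 0`, which leaves room for the larger `K`.
  have hd2 : (2 : ℝ) ≤ d n := by exact_mod_cast hd n hn1
  rcases le_or_gt D (d n) with h | h
  · exact ⟨c, hc, le_max_left _ _, hn, hD _ h⟩
  · refine ⟨K, hK1, le_max_right _ _, lt_of_le_of_lt ?_ hn', hK _ hd2⟩
    gcongr

section Model

variable {Ω : Type*} [MeasurableSpace Ω] {P : Measure Ω} {n p d : ℕ}
  {Z : Fin n → Ω → FullData p} {ν : Measure (FullData p)}
  {A : Procedure n p} {π m : (Fin p → ℝ) → ℝ} {h : (Fin p → ℝ) → Fin d → ℝ}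
  {v q C δ σε σh : ℝ}

theorem ModelAssumptions.measurable_tPiAvg [IsProbabilityMeasure ν]
    (H : ModelAssumptions P Z ν A π m h v q C δ σε σh) : Measurable (tPiAvg A Z π m h) := by
  refine measurable_pi_lambda _ fun j => ?_
  simp only [tPiAvg_apply]
  refine Finset.measurable_sum _ fun i _ => ?_
  have hZ : Measurable fun ω i => Z i ω := measurable_pi_lambda _ H.sample.measurable
  exact ((measurable_errWeight H.tail.measurable_fit H.propensity.1 H.measurable_h j i).comp
    (measurable_obsPairs.comp hZ)).mul
      ((measurable_err H.regression.2.1).comp (H.sample.measurable i))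

/-- Takes `c = c₁ = c₂ = K` and removes model-dependent quantities from the constant: `‖μ‖ ≤ σ_h²`,
`√(log d / n) ≤ 1`, and `c₃` is replaced by its upper bound `c₃'`. -/
theorem ModelAssumptions.measureReal_lt_norm_tPiAvg_le [IsProbabilityMeasure P] [IsProbabilityMeasure ν]

    (H : ModelAssumptions P Z ν A π m h v q C δ σε σh) {K c₃ c₃' η : ℝ} (hK : 1 < K)
    (hc₃ : 1 < c₃) (hc₃' : c₃ ≤ c₃') (hv : K * (v * √(Real.log (n * d))) ≤ δ / 2)
    (hlt : c₃ * √(Real.log d / n) < 1) (hη : ∀ x : ℝ, 2 ≤ x → x ^ (-(K ^ 2 - 1)) ≤ η)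
    (hη₃ : (d : ℝ) ^ (-(c₃ ^ 2 - 1)) ≤ η) :
    P.real {ω | K * const1 K σε δ * √(σh ^ 2 / δ + const2 c₃' σh δ) *
        (√(Real.log d / n) * (v * √(Real.log (n * d)))) < ‖tPiAvg A Z π m h ω‖} ≤
      (6 + 4 * C) * η + 4 * (q * (n * d)) := by
  have hmain := H.le_measureReal_norm_tPiAvg_le hK hK hK hc₃ hv hlt
  have hδ := H.basic.delta_pos
  have hσε := H.subGaussian.sigma_err_nonneg
  have hv0 := H.tail.v_nonneg
  have hC := H.tail.C_nonneg
  have hn1 : (1 : ℝ) ≤ n := by exact_mod_cast H.one_le_n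
  have hd2 : (2 : ℝ) ≤ d := by exact_mod_cast H.two_le_d
  have hr1 : √(Real.log d / n) ≤ 1 := by nlinarith [Real.sqrt_nonneg (Real.log d / n)]
  have hc1 : 0 ≤ const1 K σε δ := by unfold const1; positivity
  have hc2 : const2 c₃ σh δ * √(Real.log d / n) ≤ const2 c₃' σh δ := by
    have h0 : 0 ≤ const2 c₃ σh δ := by unfold const2; positivity
    refine (mul_le_of_le_one_right h0 hr1).trans ?_
    unfold const2
    gcongr
  set u := K * √(Real.log d / n) * (v * √(Real.log (n * d))) * const1 K σε δ *
    √(‖secondMoment ν h‖ / δ + const2 c₃ σh δ * √(Real.log d / n)) with hu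
  have hule : u ≤ K * const1 K σε δ * √(σh ^ 2 / δ + const2 c₃' σh δ) *
      (√(Real.log d / n) * (v * √(Real.log (n * d)))) := by
    calc u ≤ K * √(Real.log d / n) * (v * √(Real.log (n * d))) * const1 K σε δ *
          √(σh ^ 2 / δ + const2 c₃' σh δ) := by
          rw [hu]
          gcongr
          exact norm_secondMoment_le H.measurable_h H.subGaussian
      _ = _ := by ring
  have hmeas : MeasurableSet {ω | ‖tPiAvg A Z π m h ω‖ ≤ u} :=
    measurableSet_le H.measurable_tPiAvg.norm measurable_const
  have hcompl : P.real {ω | ‖tPiAvg A Z π m h ω‖ ≤ u}ᶜ =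
      1 - P.real {ω | ‖tPiAvg A Z π m h ω‖ ≤ u} := probReal_compl_eq_one_sub hmeas
  have hsub : P.real {ω | K * const1 K σε δ * √(σh ^ 2 / δ + const2 c₃' σh δ) *
        (√(Real.log d / n) * (v * √(Real.log (n * d)))) < ‖tPiAvg A Z π m h ω‖} ≤
      P.real {ω | ‖tPiAvg A Z π m h ω‖ ≤ u}ᶜ :=
    measureReal_mono fun ω hω => not_le.2 (hule.trans_lt hω)
  have e1 := hη d hd2
  have e2 := mul_le_mul_of_nonneg_left (hη (n * d) (by nlinarith)) hC
  linarith

end Model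

theorem measureReal_lt_le_of_le {Ω : Type*} [MeasurableSpace Ω] {P : Measure Ω}
    [IsProbabilityMeasure P] (S : Ω → ℝ) {a b : ℝ} (hab : a ≤ b) :
    P.real {ω | b < S ω} ≤ P.real {ω | a < S ω} :=
  measureReal_mono fun _ hω => hab.trans_lt hω

/-! ### Stochastic order along a sequence of models -/

section Sequence

variable {Ω : ℕ → Type*} [∀ n, MeasurableSpace (Ω n)] {P : ∀ n, Measure (Ω n)}
  [∀ n, IsProbabilityMeasure (P n)] {p d : ℕ → ℕ}
  {Z : ∀ n, Fin n → Ω n → FullData (p n)} {ν : ∀ n, Measure (FullData (p n))}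
  [∀ n, IsProbabilityMeasure (ν n)] {A : ∀ n, Procedure n (p n)}
  {π m : ∀ n, (Fin (p n) → ℝ) → ℝ} {h : ∀ n, (Fin (p n) → ℝ) → Fin (d n) → ℝ}
  {v q : ℕ → ℝ} {C δ σε σh : ℝ}

/-- `‖T_{π,n}‖ = O_P(√(log d / n) v √(log (n d)))`. -/
theorem exists_eventually_measureReal_lt_norm_tPiAvg_le
    (H : ∀ n, 1 ≤ n → ModelAssumptions (P n) (Z n) (ν n) (A n) (π n) (m n) (h n) (v n) (q n)
      C δ σε σh)
    (hv : Tendsto (fun n => v n * √(Real.log (n * d n))) atTop (𝓝 0))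
    (hq : Tendsto (fun n => q n * (n * d n)) atTop (𝓝 0)) {c : ℝ} (hc : 1 < c)
    (hlt : ∀ᶠ n : ℕ in atTop, c * √(Real.log (d n) / n) < 1) {η : ℝ} (hη : 0 < η) :
    ∃ M : ℝ, 0 < M ∧ ∀ᶠ n : ℕ in atTop,
      (P n).real {ω | M * (√(Real.log (d n) / n) * (v n * √(Real.log (n * d n)))) <
        ‖tPiAvg (A n) (Z n) (π n) (m n) (h n) ω‖} ≤ η := by
  have hC := (H 1 le_rfl).tail.C_nonneg
  have hδ := (H 1 le_rfl).basic.delta_pos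
  have hσε := (H 1 le_rfl).subGaussian.sigma_err_nonneg
  set η' := η / (2 * (6 + 4 * C)) with hη'
  have hη'0 : 0 < η' := by positivity
  obtain ⟨K, hK1, hK⟩ := exists_forall_rpow_neg_le hη'0
  obtain ⟨c', hc'⟩ := exists_bernstein_threshold (fun n hn => (H n hn).two_le_d) hc hlt hη'0
  have hc1 : 0 ≤ const1 K σε δ := by unfold const1; positivity
  -- The summand `1` keeps the constant positive even when `σ_ε = 0`.
  refine ⟨K * const1 K σε δ * √(σh ^ 2 / δ + const2 c' σh δ) + 1, by positivity, ?_⟩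
  have hv' : Tendsto (fun n => K * (v n * √(Real.log (n * d n)))) atTop (𝓝 0) := by
    simpa using hv.const_mul K
  filter_upwards [hc', hv'.eventually_le_const (half_pos hδ),
    hq.eventually_le_const (by positivity : 0 < η / 8), eventually_ge_atTop 1]
    with n ⟨c₃, h1, h2, h3, h4⟩ hvn hqn hn1
  have hv0 := (H n hn1).tail.v_nonneg
  have h5 := (H n hn1).measureReal_lt_norm_tPiAvg_le hK1 h1 h2 hvn h3 hK h4
  have h6 : (6 + 4 * C) * η' = η / 2 := by rw [hη']; field_simp
  refine (measureReal_lt_le_of_le _ ?_).trans (h5.trans (by linarith))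
  gcongr
  linarith

/-- `‖T_{π,n}‖ = o_P(√(log d / n))`. -/
theorem tendsto_measureReal_lt_norm_tPiAvg
    (H : ∀ n, 1 ≤ n → ModelAssumptions (P n) (Z n) (ν n) (A n) (π n) (m n) (h n) (v n) (q n)
      C δ σε σh)
    (hv : Tendsto (fun n => v n * √(Real.log (n * d n))) atTop (𝓝 0))
    (hq : Tendsto (fun n => q n * (n * d n)) atTop (𝓝 0)) {c : ℝ} (hc : 1 < c)
    (hlt : ∀ᶠ n : ℕ in atTop, c * √(Real.log (d n) / n) < 1) {η : ℝ} (hη : 0 < η) :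
    Tendsto (fun n => (P n).real {ω | η * √(Real.log (d n) / n) <
      ‖tPiAvg (A n) (Z n) (π n) (m n) (h n) ω‖}) atTop (𝓝 0) := by
  refine tendsto_order.2 ⟨fun a ha => Eventually.of_forall fun n =>
    ha.trans_le measureReal_nonneg, fun a ha => ?_⟩
  -- `M` depends on the target probability `a`; since `M v √log(nd) → 0`, it is eventually absorbed
  -- by `η`.
  obtain ⟨M, hM, hMn⟩ :=
    exists_eventually_measureReal_lt_norm_tPiAvg_le H hv hq hc hlt (half_pos ha)
  have hv' : Tendsto (fun n => M * (v n * √(Real.log (n * d n)))) atTop (𝓝 0) := by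
    simpa using hv.const_mul M
  filter_upwards [hMn, hv'.eventually_le_const hη] with n hn hvn
  refine lt_of_le_of_lt ((measureReal_lt_le_of_le _ ?_).trans hn)
    (half_lt_self ha)
  calc M * (√(Real.log (d n) / n) * (v n * √(Real.log (n * d n))))
      = M * (v n * √(Real.log (n * d n))) * √(Real.log (d n) / n) := by ring
    _ ≤ _ := by gcongr

end Sequence

end DDR

theorem mainTheorem4 :
    -- the non-asymptotic bound
    (∀ {Ω : Type*} [MeasurableSpace Ω] (P : Measure Ω) [IsProbabilityMeasure P] {n p d : ℕ}
      (Z : Fin n → Ω → DDR.FullData p) (ν : Measure (DDR.FullData p)) [IsProbabilityMeasure ν]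
      (A : DDR.Procedure n p) (π m : (Fin p → ℝ) → ℝ) (h : (Fin p → ℝ) → Fin d → ℝ)
      (v q C δ σε σh : ℝ),
      DDR.ModelAssumptions P Z ν A π m h v q C δ σε σh →
      ∀ c c₁ c₂ c₃ : ℝ, 1 < c → 1 < c₁ → 1 < c₂ → 1 < c₃ →
        c₂ * (v * √(Real.log (n * d))) ≤ δ / 2 →
        c₃ * √(Real.log d / n) < 1 →
        1 - 2 * (d : ℝ) ^ (-(c ^ 2 - 1)) - 4 * (d : ℝ) ^ (-(c₃ ^ 2 - 1))
            - 2 * C * ((n : ℝ) * d) ^ (-(c₁ ^ 2 - 1)) - 2 * C * ((n : ℝ) * d) ^ (-(c₂ ^ 2 - 1))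
            - 4 * q * (n * d) ≤
          P.real {ω | ‖DDR.tPiAvg A Z π m h ω‖ ≤
            c * √(Real.log d / n) * (v * √(Real.log (n * d))) * DDR.const1 c₁ σε δ *
              √(‖DDR.secondMoment ν h‖ / δ + DDR.const2 c₃ σh δ * √(Real.log d / n))}) ∧
    -- the asymptotic consequences, along a sequence of models with the same constants
    (∀ {Ω : ℕ → Type*} [∀ n, MeasurableSpace (Ω n)] (P : ∀ n, Measure (Ω n))
      [∀ n, IsProbabilityMeasure (P n)] (p d : ℕ → ℕ)
      (Z : ∀ n, Fin n → Ω n → DDR.FullData (p n)) (ν : ∀ n, Measure (DDR.FullData (p n)))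
      [∀ n, IsProbabilityMeasure (ν n)] (A : ∀ n, DDR.Procedure n (p n))
      (π m : ∀ n, (Fin (p n) → ℝ) → ℝ) (h : ∀ n, (Fin (p n) → ℝ) → Fin (d n) → ℝ)
      (v q : ℕ → ℝ) (C δ σε σh : ℝ),
      (∀ n, 1 ≤ n →
        DDR.ModelAssumptions (P n) (Z n) (ν n) (A n) (π n) (m n) (h n) (v n) (q n) C δ σε σh) →
      Tendsto (fun n => v n * √(Real.log (n * d n))) atTop (𝓝 0) →
      Tendsto (fun n => q n * (n * d n)) atTop (𝓝 0) →
      (∃ c₃ : ℝ, 1 < c₃ ∧ ∀ᶠ n : ℕ in atTop, c₃ * √(Real.log (d n) / n) < 1) →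
      (∀ η : ℝ, 0 < η → ∃ M : ℝ, 0 < M ∧ ∀ᶠ n : ℕ in atTop,
        (P n).real {ω | M * (√(Real.log (d n) / n) * (v n * √(Real.log (n * d n)))) <
          ‖DDR.tPiAvg (A n) (Z n) (π n) (m n) (h n) ω‖} ≤ η) ∧
      (∀ η : ℝ, 0 < η → Tendsto (fun n => (P n).real {ω | η * √(Real.log (d n) / n) <
          ‖DDR.tPiAvg (A n) (Z n) (π n) (m n) (h n) ω‖}) atTop (𝓝 0))) := by
  refine ⟨fun P _ _ _ _ Z ν _ A π m h v q C δ σε σh H c c₁ c₂ c₃ hc hc₁ hc₂ hc₃ hv hlt =>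
    H.le_measureReal_norm_tPiAvg_le hc hc₁ hc₂ hc₃ hv hlt, ?_⟩
  rintro Ω _ P _ p d Z ν _ A π m h v q C δ σε σh H hv hq ⟨c, hc, hlt⟩
  exact ⟨fun η hη => DDR.exists_eventually_measureReal_lt_norm_tPiAvg_le H hv hq hc hlt hη,
    fun η hη => DDR.tendsto_measureReal_lt_norm_tPiAvg H hv hq hc hlt hη⟩
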